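/- Let $G_1, G_2$ be separable (i.e. second countable) locally compact Hausdorff abelian groups whose Moore cohomology groups $H^3(G_j,\mathsf U(1))$ (Borel cochains, trivial action) are trivial, let $G=G_1\times G_2$, and let $A$ be a stable $C^*$-algebra with multiplier algebra $M(A)$. Lower case letters $x,y,z$ denote elements of $G_1$ and capitals $X,Y,Z$ elements of $G_2$, both regarded as elements of $G$. Let $\phi\colon G^3\to \mathsf U(1)$ be an antisymmetric tricharacter (a continuous character in each argument, inverted by each transposition of the arguments) which is identically $1$ on $G_1$ and is $1$ whenever two of its arguments lie in $G_2$. A (Borel) twisted action with three-cocycle $\varphi\colon G^3\to\mathsf U(1)$ is a pair $(\beta,v)$ of maps $\beta\colon G\to\mathrm{Aut}(A)$ and $v\colon G\times G\to \mathcal U(M(A))$, with $\xi\mapsto\beta_\xi(a)$, $(\xi,\eta)\mapsto v(\xi,\eta)a$ and $(\xi,\eta)\mapsto a\,v(\xi,\eta)$ strongly measurable for every $a\in A$, such that $$\beta_\xi\beta_\eta=\mathrm{ad}(v(\xi,\eta))\,\beta_{\xi\eta},\qquad v(\xi,\eta)v(\xi\eta,\zeta)=\varphi(\xi,\eta,\zeta)\,\beta_\xi[v(\eta,\zeta)]\,v(\xi,\eta\zeta).$$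 Two twisted actions $(\beta,v)$, $(\beta',v')$ are exterior equivalent if there are unitaries $w_\xi\in \mathcal U(M(A))$, with $\xi\mapsto w_\xi a$ and $\xi\mapsto a w_\xi$ strongly measurable for all $a\in A$, such that $\beta'_\xi=\mathrm{ad}(w_\xi)\beta_\xi$ and $v'(\xi,\eta)=w_\xi\beta_\xi[w_\eta]v(\xi,\eta)w_{\xi\eta}^{-1}$. They are exterior equivalent up to scalars if instead $v'(\xi,\eta)=c(\xi,\eta)\,w_\xi\beta_\xi[w_\eta]v(\xi,\eta)w_{\xi\eta}^{-1}$ for a Borel function $c\colon G\times G\to\mathsf U(1)$, and their three-cocycles are related by $\varphi'=\varphi\cdot dc$, where $(dc)(\xi,\eta,\zeta)=\dfrac{c(\xi,\eta)c(\xi\eta,\zeta)}{c(\xi,\eta\zeta)c(\eta,\zeta)}$. Let $(\beta,v)$ be a twisted action of $G$ on $A$ with three-cocycle $\phi$. Then: 1. We may take $v$ to be trivial on the subgroups $G_j$: $(\beta,v)$ is exterior equivalent to a twisted action $(\beta',v')$ with three-cocycle $\phi$ and $v'(x,y)=1$, $v'(X,Y)=1$ for all $x,y\in G_1$, $X,Y\in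 G_2$. 2. For every such $(\beta',v')$, set $\tilde v(X,y)=v'(X,y)v'(y,X)^{-1}$, $\hat\beta_{xX}=\beta'_x\beta'_X$ and $\hat v(xX,yY)=\beta'_x[\tilde v(X,y)]$. Then $(\hat\beta,\hat v)$ is a twisted action with three-cocycle $\hat\phi(xX,yY,zZ)=\phi(X,y,z)^3$; both $(\beta',v')$ and $(\beta,v)$ are exterior equivalent up to scalars to $(\hat\beta,\hat v)$; and $$\tilde v(XY,z)=\beta'_X[\tilde v(Y,z)]\,\tilde v(X,z),\qquad \tilde v(X,yz)=\phi(X,y,z)^{-3}\,\tilde v(X,y)\,\beta'_y[\tilde v(X,z)].$$ 3. The antisymmetrisation of $\hat\phi$ is $\phi$: for $\xi=xX$, $\eta=yY$, $\zeta=zZ$, $$\hat\phi(\xi,\eta,\zeta)\,\hat\phi(\eta,\zeta,\xi)\,\hat\phi(\zeta,\xi,\eta)=\phi(\xi,\eta,\zeta)^3,\qquad \phi(X,y,z)\,\phi(Y,z,x)\,\phi(Z,x,y)=\phi(\xi,\eta,\zeta).$$ -/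

import Mathlib

open MeasureTheory
open scoped MultiplierAlgebra

noncomputable section

namespace TwistedAction

/-! ### Multipliers and automorphisms of a C⋆-algebra -/

section Multiplier

variable {A : Type*} [NonUnitalCStarAlgebra A]

theorem eq_of_forall_mul_left {c d : A} (h : ∀ z : A, z * c = z * d) : c = d := by
  have h1 : star (c - d) * (c - d) = 0 := by rw [mul_sub, h, sub_self]
  exact sub_eq_zero.mp (CStarRing.star_mul_self_eq_zero_iff _ |>.mp h1)

theorem eq_of_forall_mul_right {c d : A} (h : ∀ z : A, c * z = d * z) : c = d := by
  have h1 : (c - d) * star (c - d) = 0 := by rw [sub_mul, h, sub_self]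
  exact sub_eq_zero.mp (CStarRing.mul_star_self_eq_zero_iff _ |>.mp h1)

/-- `m (a b) = (m a) b` for a multiplier `m`. -/
theorem fst_mul (m : 𝓜(ℂ, A)) (a b : A) : m.fst (a * b) = m.fst a * b :=
  eq_of_forall_mul_left fun z => by
    rw [← m.central, ← mul_assoc, ← mul_assoc, m.central]

/-- `(a b) m = a (b m)` for a multiplier `m`. -/
theorem snd_mul (m : 𝓜(ℂ, A)) (a b : A) : m.snd (a * b) = a * m.snd b :=
  eq_of_forall_mul_right fun z => by
    rw [m.central, mul_assoc, mul_assoc, m.central]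

/-- `m (a n) = (m a) n` for multipliers `m`, `n`. -/
theorem fst_snd (m n : 𝓜(ℂ, A)) (a : A) : m.fst (n.snd a) = n.snd (m.fst a) :=
  eq_of_forall_mul_left fun z => by
    rw [← m.central, ← snd_mul, ← snd_mul, m.central]

theorem fst_star_mul_cancel (u : unitary 𝓜(ℂ, A)) (a : A) :
    (star (u : 𝓜(ℂ, A))).fst ((u : 𝓜(ℂ, A)).fst a) = a := by
  exact congrArg (fun m : 𝓜(ℂ, A) => m.fst a) (Unitary.coe_star_mul_self u)

theorem fst_mul_star_cancel (u : unitary 𝓜(ℂ, A)) (a : A) :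
    (u : 𝓜(ℂ, A)).fst ((star (u : 𝓜(ℂ, A))).fst a) = a := by
  exact congrArg (fun m : 𝓜(ℂ, A) => m.fst a) (Unitary.coe_mul_star_self u)

theorem snd_star_mul_cancel (u : unitary 𝓜(ℂ, A)) (a : A) :
    (u : 𝓜(ℂ, A)).snd ((star (u : 𝓜(ℂ, A))).snd a) = a := by
  exact congrArg (fun m : 𝓜(ℂ, A) => m.snd a) (Unitary.coe_star_mul_self u)

theorem snd_mul_star_cancel (u : unitary 𝓜(ℂ, A)) (a : A) :
    (star (u : 𝓜(ℂ, A))).snd ((u : 𝓜(ℂ, A)).snd a) = a := by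
  exact congrArg (fun m : 𝓜(ℂ, A) => m.snd a) (Unitary.coe_mul_star_self u)

/-- The automorphism `ad(u) : a ↦ u a u⁻¹` of `A` given by a unitary multiplier `u`. Here
`m.fst a` and `m.snd a` are the products `m a` and `a m` of `a : A` with a multiplier `m`. -/
def ad (u : unitary 𝓜(ℂ, A)) : A ≃⋆ₐ[ℂ] A where
  toFun a := (u : 𝓜(ℂ, A)).fst ((star (u : 𝓜(ℂ, A))).snd a)
  invFun a := (star (u : 𝓜(ℂ, A))).fst ((u : 𝓜(ℂ, A)).snd a)
  left_inv a := by
    beta_reduce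
    rw [← fst_snd (u : 𝓜(ℂ, A)) (u : 𝓜(ℂ, A)), fst_star_mul_cancel, snd_star_mul_cancel]
  right_inv a := by
    beta_reduce
    rw [← fst_snd (star (u : 𝓜(ℂ, A))) (star (u : 𝓜(ℂ, A))), fst_mul_star_cancel,
      snd_mul_star_cancel]
  map_mul' a b := by
    have h : (star (u : 𝓜(ℂ, A))).snd a * (u : 𝓜(ℂ, A)).fst ((star (u : 𝓜(ℂ, A))).snd b)
        = (star (u : 𝓜(ℂ, A))).snd (a * b) := by
      rw [← (u : 𝓜(ℂ, A)).central, snd_star_mul_cancel, snd_mul]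
    rw [← fst_mul, h]
  map_add' a b := by simp only [map_add]
  map_smul' c a := by simp only [map_smul]
  map_star' a := by
    rw [fst_snd, DoubleCentralizer.star_snd, DoubleCentralizer.star_snd]

/-- An automorphism of a C⋆-algebra as a continuous linear map. -/
def autCLM (β : A ≃⋆ₐ[ℂ] A) : A →L[ℂ] A where
  toFun a := β a
  map_add' a b := map_add β a b
  map_smul' c a := map_smul β c a
  cont := (NonUnitalStarAlgHom.isometry β β.injective).continuous

@[simp]
theorem autCLM_apply (β : A ≃⋆ₐ[ℂ] A) (a : A) : autCLM β a = β a := rfl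

/-- The canonical extension of an automorphism `β` of `A` to the multiplier algebra, determined by
`β(m) β(a) = β(m a)` and `β(a) β(m) = β(a m)`. -/
def extend (β : A ≃⋆ₐ[ℂ] A) : 𝓜(ℂ, A) →⋆ₐ[ℂ] 𝓜(ℂ, A) where
  toFun m :=
    { fst := (autCLM β).comp (m.fst.comp (autCLM β.symm))
      snd := (autCLM β).comp (m.snd.comp (autCLM β.symm))
      central := fun x y => by
        have h := congrArg β (m.central (β.symm x) (β.symm y))
        simpa using h }
  map_one' := by
    ext a <;> simp
  map_mul' m n := by
    ext a <;> simp
  map_zero' := by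
    ext a <;> simp
  map_add' m n := by
    ext a <;> simp
  commutes' c := by
    ext a <;> simp [Algebra.algebraMap_eq_smul_one]
  map_star' m := by
    ext a <;> simp [map_star]

/-- The action of an automorphism of `A` on the unitary group of the multiplier algebra. -/
def onUnitary (β : A ≃⋆ₐ[ℂ] A) : unitary 𝓜(ℂ, A) →⋆* unitary 𝓜(ℂ, A) :=
  Unitary.map
    { toFun := extend β
      map_one' := map_one (extend β)
      map_mul' := map_mul (extend β)
      map_star' := map_star (extend β) }

/-- A family of unitary multipliers is strictly (strongly) measurable if its products with every
element of `A`, on the left and on the right, are strongly measurable. For separable `A` this is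
Borel measurability for the strict topology. -/
def StrictlyMeasurable {S : Type*} [MeasurableSpace S] (u : S → unitary 𝓜(ℂ, A)) : Prop :=
  ∀ a : A, StronglyMeasurable (fun s => (u s : 𝓜(ℂ, A)).fst a) ∧
    StronglyMeasurable (fun s => (u s : 𝓜(ℂ, A)).snd a)

variable (A) in
/-- `A` is stable, `A ≅ A ⊗ 𝒦(ℓ²(ℕ))`. The C⋆-algebra `A ⊗ 𝒦` is the completion of the
⋆-algebra of finitely supported matrices `∑ aᵢⱼ ⊗ eᵢⱼ` over `A` in its unique C⋆-norm, so an
isomorphism `A ⊗ 𝒦 ≅ A` is the same as an injective ⋆-homomorphism from that ⋆-algebra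
to `A` with dense range; `e i j a` is the image of `a ⊗ eᵢⱼ`. -/
def IsStable : Prop :=
  ∃ e : ℕ → ℕ → A →ₗ[ℂ] A,
    (∀ i j k l a b, e i j a * e k l b = if j = k then e i l (a * b) else 0) ∧
    (∀ i j a, star (e i j a) = e j i (star a)) ∧
    (∀ i j, Function.Injective (e i j)) ∧
    Dense ((⨆ i, ⨆ j, LinearMap.range (e i j) : Submodule ℂ A) : Set A)

end Multiplier

/-! ### `U(1)`-valued cochains -/

section Cochains

variable {G : Type*} [CommGroup G]

/-- The coboundary `(dc)(x,y,z) = c(x,y) c(xy,z) / (c(x,yz) c(y,z))` of a `U(1)`-valued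
two-cochain. -/
def coboundary (c : G → G → Circle) (x y z : G) : Circle :=
  c x y * c (x * y) z / (c x (y * z) * c y z)

/-- The three-cocycle (pentagon) identity, for the trivial action on `U(1)`. -/
def IsThreeCocycle (f : G → G → G → Circle) : Prop :=
  ∀ x y z t, f y z t * f x (y * z) t * f x y z = f (x * y) z t * f x y (z * t)

variable (G) in
/-- The Moore cohomology group `H³(G, U(1))` (cohomology of the complex of Borel cochains, with
trivial action on `U(1)`) is trivial: each Borel three-cocycle is the coboundary of a Borel
two-cochain. -/
def MooreH3Trivial [MeasurableSpace G] : Prop :=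
  ∀ f : G → G → G → Circle, Measurable (fun p : G × G × G => (f p.1 p.2.1 p.2.2 : ℂ)) →
    IsThreeCocycle f →
      ∃ c : G → G → Circle, Measurable (fun p : G × G => (c p.1 p.2 : ℂ)) ∧
        ∀ x y z, f x y z = coboundary c x y z

/-- Antisymmetric tricharacters: (continuous) characters in each argument, inverted by every
transposition of the arguments. -/
structure IsAntisymmTricharacter [TopologicalSpace G] (φ : G → G → G → Circle) : Prop where
  map_mul₁ : ∀ x x' y z, φ (x * x') y z = φ x y z * φ x' y z
  map_mul₂ : ∀ x y y' z, φ x (y * y') z = φ x y z * φ x y' z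
  map_mul₃ : ∀ x y z z', φ x y (z * z') = φ x y z * φ x y z'
  continuous₁ : ∀ y z, Continuous fun x => φ x y z
  continuous₂ : ∀ x z, Continuous fun y => φ x y z
  continuous₃ : ∀ x y, Continuous fun z => φ x y z
  swap₁₂ : ∀ x y z, φ y x z = (φ x y z)⁻¹
  swap₂₃ : ∀ x y z, φ x z y = (φ x y z)⁻¹
  swap₁₃ : ∀ x y z, φ z y x = (φ x y z)⁻¹

end Cochains

/-! ### Twisted actions and exterior equivalence -/

section Actions

variable {G A : Type*} [CommGroup G] [MeasurableSpace G] [NonUnitalCStarAlgebra A]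

/-- `β : G → Aut(A)` is a (Borel) twisted homomorphism with unitary multiplier-valued twisting `v`
and three-cocycle `φ`. -/
structure IsTwistedAction (β : G → (A ≃⋆ₐ[ℂ] A)) (v : G → G → unitary 𝓜(ℂ, A))
    (φ : G → G → G → Circle) : Prop where
  measurable_action : ∀ a : A, StronglyMeasurable fun x => β x a
  measurable_twist : StrictlyMeasurable fun p : G × G => v p.1 p.2
  comp : ∀ x y, β x * β y = ad (v x y) * β (x * y)
  cocycle : ∀ x y z, ((v x y * v (x * y) z : unitary 𝓜(ℂ, A)) : 𝓜(ℂ, A)) =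
    (φ x y z : ℂ) • ((onUnitary (β x) (v y z) * v x (y * z) : unitary 𝓜(ℂ, A)) : 𝓜(ℂ, A))

/-- Exterior equivalence of `(β, v)` with `(β', v')`:
`β'_x = ad(w_x) β_x` and `v'(x,y) = w_x β_x(w_y) v(x,y) w_{xy}⁻¹`. -/
def ExteriorEquivalent (β : G → (A ≃⋆ₐ[ℂ] A)) (v : G → G → unitary 𝓜(ℂ, A))
    (β' : G → (A ≃⋆ₐ[ℂ] A)) (v' : G → G → unitary 𝓜(ℂ, A)) : Prop :=
  ∃ w : G → unitary 𝓜(ℂ, A), StrictlyMeasurable w ∧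
    (∀ x, β' x = ad (w x) * β x) ∧
    ∀ x y, v' x y = w x * onUnitary (β x) (w y) * v x y * (w (x * y))⁻¹

/-- Exterior equivalence up to scalars of `(β, v)`, with three-cocycle `φ`, and `(β', v')`, with
three-cocycle `φ'`: for some Borel two-cochain `c` with values in `U(1)`,
`β'_x = ad(w_x) β_x`, `v'(x,y) = c(x,y) w_x β_x(w_y) v(x,y) w_{xy}⁻¹` and `φ' = φ · dc`. -/
def ExteriorEquivalentUpToScalars (β : G → (A ≃⋆ₐ[ℂ] A)) (v : G → G → unitary 𝓜(ℂ, A))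
    (φ : G → G → G → Circle) (β' : G → (A ≃⋆ₐ[ℂ] A)) (v' : G → G → unitary 𝓜(ℂ, A))
    (φ' : G → G → G → Circle) : Prop :=
  ∃ (w : G → unitary 𝓜(ℂ, A)) (c : G → G → Circle), StrictlyMeasurable w ∧
    Measurable (fun p : G × G => (c p.1 p.2 : ℂ)) ∧
    (∀ x, β' x = ad (w x) * β x) ∧
    (∀ x y, (v' x y : 𝓜(ℂ, A)) = (c x y : ℂ) •
      ((w x * onUnitary (β x) (w y) * v x y * (w (x * y))⁻¹ : unitary 𝓜(ℂ, A)) : 𝓜(ℂ, A))) ∧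
    ∀ x y z, φ' x y z = φ x y z * coboundary c x y z

end Actions

/-! ### Actions of a product group -/

section Product

variable {G₁ G₂ A : Type*} [CommGroup G₁] [CommGroup G₂] [NonUnitalCStarAlgebra A]

/-- `v` is trivial on each of the subgroups `G₁` and `G₂` of `G₁ × G₂`. -/
def TrivialOnFactors (v : G₁ × G₂ → G₁ × G₂ → unitary 𝓜(ℂ, A)) : Prop :=
  (∀ x y : G₁, v (x, 1) (y, 1) = 1) ∧ ∀ X Y : G₂, v (1, X) (1, Y) = 1

/-- `β̂_{xX} = β_x β_X`. -/
def hatAction (β : G₁ × G₂ → (A ≃⋆ₐ[ℂ] A)) (ξ : G₁ × G₂) : A ≃⋆ₐ[ℂ] A :=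
  β (ξ.1, 1) * β (1, ξ.2)

/-- `ṽ(X, y) = v(X, y) v(y, X)⁻¹`. -/
def tildeTwist (v : G₁ × G₂ → G₁ × G₂ → unitary 𝓜(ℂ, A)) (X : G₂) (y : G₁) :
    unitary 𝓜(ℂ, A) :=
  v (1, X) (y, 1) * (v (y, 1) (1, X))⁻¹

/-- `v̂(xX, yY) = β_x[ṽ(X, y)]`. -/
def hatTwist (β : G₁ × G₂ → (A ≃⋆ₐ[ℂ] A)) (v : G₁ × G₂ → G₁ × G₂ → unitary 𝓜(ℂ, A))
    (ξ η : G₁ × G₂) : unitary 𝓜(ℂ, A) :=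
  onUnitary (β (ξ.1, 1)) (tildeTwist v ξ.2 η.1)

/-- `φ̂(xX, yY, zZ) = φ(X, y, z)³`. -/
def hatCocycle (φ : G₁ × G₂ → G₁ × G₂ → G₁ × G₂ → Circle) (ξ η ζ : G₁ × G₂) : Circle :=
  φ (1, ξ.2) (η.1, 1) (ζ.1, 1) ^ 3

end Product

end TwistedAction

end

open TwistedAction

noncomputable section

namespace TwistedAction

/-! ### Unitary multipliers -/

section Unitaries

variable {A : Type*} [NonUnitalCStarAlgebra A]

/-! Two ingredients carry the proof: the stabilisation trick of Packer and Raeburn, and an explicit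
scalar cochain.

For part 1, `φ` is 1 on each factor, so each restricted twisted action has trivial three-cocycle. On
`L²(G_j; A)` put `(W_x g)(t) = v(x, x⁻¹t)⁻¹ β_x(g(x⁻¹t))`. The cocycle identity makes `W_x W_y`
equal to `W_{xy}` followed by right multiplication by `v(x,y)⁻¹`. Stability supplies a map `U` from
`L²(G_j; A)` to `A` with dense range that preserves `A`-valued inner products
(`exists_unitary_of_isStable`), so `W_x` is transported to an operator `Y_x` on `A`. The product
`Y_x β_x⁻¹` preserves `a⋆ b` and is onto, hence is left multiplication by a unitary multiplier
`w_x`, and `w_{xy} = w_x β_x(w_y) v(x,y)` (`exists_untwisting`). The two families agree at 1 and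
glue to unitaries on `G₁ × G₂`.

For part 2, perturb by `w_{xX} = v'(x,X)`. Then `ad(w) β'` is `β̂`, and five instances of the
relations for `(β', v')` show that the perturbed twist is `v̂` up to a scalar cochain
(`hatTwist_eq`). With `f(x,y;X) = φ(X,x,y)` this cochain is `c(xX,yY) = f(x,y;X)² f(x,y;Y)`. Its
coboundary is `f(y,z;X)² f(x,z;Y) f(x,y;Z)⁻¹`, while `φ = f(y,z;X) f(z,x;Y) f(x,y;Z)`; the product
is `f(y,z;X)³`, which is `φ̂`. Since perturbation preserves twisted actions
(`IsTwistedAction.exterior`), `(β̂, v̂)` is one, and the identities for `ṽ` are special cases of its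
cocycle identity.

Part 3 is the expansion of `φ` by multiplicativity: only terms with exactly one argument in `G₂`
survive (`eq_cyclic`). -/

/-- A multiplier of a C⋆-algebra is determined by its left action. -/
theorem multiplier_ext {m n : 𝓜(ℂ, A)} (h : ∀ a, m.fst a = n.fst a) : m = n := by
  refine DoubleCentralizer.ext _ _ _ _ (Prod.ext ?_ ?_)
  · exact ContinuousLinearMap.ext h
  · refine ContinuousLinearMap.ext fun a => eq_of_forall_mul_right fun z => ?_
    exact (m.central a z).trans ((congrArg (a * ·) (h z)).trans (n.central a z).symm)

theorem unitary_ext {u w : unitary 𝓜(ℂ, A)}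
    (h : ∀ a, (u : 𝓜(ℂ, A)).fst a = (w : 𝓜(ℂ, A)).fst a) : u = w :=
  Subtype.ext (multiplier_ext h)

theorem coe_mul_fst (u w : unitary 𝓜(ℂ, A)) (a : A) :
    ((u * w : unitary 𝓜(ℂ, A)) : 𝓜(ℂ, A)).fst a = (u : 𝓜(ℂ, A)).fst ((w : 𝓜(ℂ, A)).fst a) := rfl

theorem coe_inv_eq_star (u : unitary 𝓜(ℂ, A)) :
    ((u⁻¹ : unitary 𝓜(ℂ, A)) : 𝓜(ℂ, A)) = star (u : 𝓜(ℂ, A)) := rfl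

theorem ad_apply (u : unitary 𝓜(ℂ, A)) (a : A) :
    ad u a = (u : 𝓜(ℂ, A)).fst ((star (u : 𝓜(ℂ, A))).snd a) := rfl

theorem onUnitary_fst (β : A ≃⋆ₐ[ℂ] A) (u : unitary 𝓜(ℂ, A)) (a : A) :
    (onUnitary β u : 𝓜(ℂ, A)).fst a = β ((u : 𝓜(ℂ, A)).fst (β.symm a)) := rfl

theorem onUnitary_snd (β : A ≃⋆ₐ[ℂ] A) (u : unitary 𝓜(ℂ, A)) (a : A) :
    (onUnitary β u : 𝓜(ℂ, A)).snd a = β ((u : 𝓜(ℂ, A)).snd (β.symm a)) := rfl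

theorem map_fst (β : A ≃⋆ₐ[ℂ] A) (u : unitary 𝓜(ℂ, A)) (a : A) :
    β ((u : 𝓜(ℂ, A)).fst a) = (onUnitary β u : 𝓜(ℂ, A)).fst (β a) := by
  rw [onUnitary_fst, StarAlgEquiv.symm_apply_apply]

theorem map_snd (β : A ≃⋆ₐ[ℂ] A) (u : unitary 𝓜(ℂ, A)) (a : A) :
    β ((u : 𝓜(ℂ, A)).snd a) = (onUnitary β u : 𝓜(ℂ, A)).snd (β a) := by
  rw [onUnitary_snd, StarAlgEquiv.symm_apply_apply]

@[simp]
theorem onUnitary_one_aut (u : unitary 𝓜(ℂ, A)) : onUnitary (1 : A ≃⋆ₐ[ℂ] A) u = u :=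
  unitary_ext fun _ => rfl

theorem onUnitary_mul_aut (β γ : A ≃⋆ₐ[ℂ] A) (u : unitary 𝓜(ℂ, A)) :
    onUnitary (β * γ) u = onUnitary β (onUnitary γ u) :=
  unitary_ext fun _ => rfl

@[simp]
theorem ad_one : ad (1 : unitary 𝓜(ℂ, A)) = 1 := by
  ext a
  rw [ad_apply]
  simp

theorem ad_mul (u w : unitary 𝓜(ℂ, A)) : ad (u * w) = ad u * ad w := by
  ext a
  change (u : 𝓜(ℂ, A)).fst ((w : 𝓜(ℂ, A)).fst ((star ((u : 𝓜(ℂ, A)) * (w : 𝓜(ℂ, A)))).snd a)) =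
    (u : 𝓜(ℂ, A)).fst ((star (u : 𝓜(ℂ, A))).snd
      ((w : 𝓜(ℂ, A)).fst ((star (w : 𝓜(ℂ, A))).snd a)))
  rw [star_mul, DoubleCentralizer.mul_snd, ← fst_snd, mul_apply_eq_comp]

theorem aut_mul_ad (β : A ≃⋆ₐ[ℂ] A) (u : unitary 𝓜(ℂ, A)) :
    β * ad u = ad (onUnitary β u) * β := by
  ext a
  change β (ad u a) = ad (onUnitary β u) (β a)
  rw [ad_apply, ad_apply, map_fst, ← coe_inv_eq_star, ← coe_inv_eq_star, map_snd, map_inv]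

theorem onUnitary_ad (u m : unitary 𝓜(ℂ, A)) : onUnitary (ad u) m = u * m * u⁻¹ := by
  refine unitary_ext fun a => ?_
  change (u : 𝓜(ℂ, A)).fst ((star (u : 𝓜(ℂ, A))).snd ((m : 𝓜(ℂ, A)).fst
      ((star (u : 𝓜(ℂ, A))).fst ((u : 𝓜(ℂ, A)).snd a)))) =
    (u : 𝓜(ℂ, A)).fst ((m : 𝓜(ℂ, A)).fst ((star (u : 𝓜(ℂ, A))).fst a))
  rw [← fst_snd, ← fst_snd, snd_mul_star_cancel]

/-- Scalars of modulus one as unitary multipliers. -/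
def scalar : Circle →* unitary 𝓜(ℂ, A) where
  toFun c := ⟨algebraMap ℂ 𝓜(ℂ, A) c, by
    rw [Unitary.mem_iff, ← algebraMap_star_comm, ← map_mul, ← map_mul]
    have h : star (c : ℂ) * c = 1 := by
      rw [mul_comm, Complex.star_def, Complex.mul_conj, Circle.normSq_coe, Complex.ofReal_one]
    exact ⟨by rw [h, map_one], by rw [mul_comm, h, map_one]⟩⟩
  map_one' := Subtype.ext (by simp)
  map_mul' c d := Subtype.ext (by simp)

theorem coe_scalar_mul (c : Circle) (u : unitary 𝓜(ℂ, A)) :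
    ((scalar c * u : unitary 𝓜(ℂ, A)) : 𝓜(ℂ, A)) = (c : ℂ) • (u : 𝓜(ℂ, A)) :=
  (Algebra.smul_def _ _).symm

/-- Turns the cocycle identities, stated with `•` in the multiplier algebra, into equations inside
the unitary group, where inverses can be cancelled. -/
theorem eq_scalar_mul_iff {c : Circle} {u w : unitary 𝓜(ℂ, A)} :
    (u : 𝓜(ℂ, A)) = (c : ℂ) • (w : 𝓜(ℂ, A)) ↔ u = scalar c * w := by
  rw [← coe_scalar_mul, Subtype.ext_iff]

theorem scalar_comm (c : Circle) (u : unitary 𝓜(ℂ, A)) : scalar c * u = u * scalar c :=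
  Subtype.ext (Algebra.commutes _ _)

theorem mul_scalar_mul (c : Circle) (u w : unitary 𝓜(ℂ, A)) :
    u * (scalar c * w) = scalar c * (u * w) := by
  rw [← mul_assoc, ← scalar_comm, mul_assoc]

theorem scalar_mul_mul_scalar_mul (c d : Circle) (u w : unitary 𝓜(ℂ, A)) :
    scalar c * u * (scalar d * w) = scalar (c * d) * (u * w) := by
  rw [map_mul, mul_scalar_mul, ← mul_assoc, ← mul_assoc, ← map_mul, mul_comm d, map_mul, mul_assoc]

@[simp]
theorem onUnitary_scalar (β : A ≃⋆ₐ[ℂ] A) (c : Circle) :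
    onUnitary β (scalar c) = scalar c :=
  Subtype.ext ((extend β).commutes' c)

@[simp]
theorem ad_scalar (c : Circle) : ad (scalar c : unitary 𝓜(ℂ, A)) = 1 := by
  ext a
  rw [ad_apply, ← coe_inv_eq_star, ← map_inv]
  change (c : ℂ) • ((c⁻¹ : Circle) : ℂ) • a = a
  rw [smul_smul, ← Circle.coe_mul, mul_inv_cancel, Circle.coe_one, one_smul]

theorem star_fst_mul_fst (u : unitary 𝓜(ℂ, A)) (a b : A) :
    star ((u : 𝓜(ℂ, A)).fst a) * (u : 𝓜(ℂ, A)).fst b = star a * b := by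
  have h := (star (u : 𝓜(ℂ, A))).central (star a) ((u : 𝓜(ℂ, A)).fst b)
  rw [fst_star_mul_cancel, DoubleCentralizer.star_snd, star_star] at h
  exact h

theorem norm_fst_apply (u : unitary 𝓜(ℂ, A)) (a : A) : ‖(u : 𝓜(ℂ, A)).fst a‖ = ‖a‖ := by
  rw [← mul_self_inj (norm_nonneg _) (norm_nonneg _), ← CStarRing.norm_star_mul_self,
    star_fst_mul_fst, CStarRing.norm_star_mul_self]

end Unitaries

/-! ### Measurability of families of multipliers -/

section Measurability

variable {S E F : Type*} [MeasurableSpace S] [NormedAddCommGroup E] [NormedSpace ℂ E]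
  [NormedAddCommGroup F] [NormedSpace ℂ F]

/-- A pointwise measurable family of operators may be applied to a measurable family of vectors. -/
theorem stronglyMeasurable_apply {T : S → E →L[ℂ] F}
    (hT : ∀ a, StronglyMeasurable fun s => T s a) {f : S → E} (hf : StronglyMeasurable f) :
    StronglyMeasurable fun s => T s (f s) := by
  have simple : ∀ g : SimpleFunc S E, StronglyMeasurable fun s => T s (g s) := by
    intro g
    induction g using SimpleFunc.induction with
    | @const c s hs =>
      have : (fun x => T x ((SimpleFunc.piecewise s hs (SimpleFunc.const S c)
          (SimpleFunc.const S 0)) x)) = s.indicator fun x => T x c := by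
        classical
        ext x
        by_cases hx : x ∈ s <;> simp [hx]
      rw [this]
      exact (hT c).indicator hs
    | add _ hf hg =>
      simp only [SimpleFunc.coe_add, Pi.add_apply, map_add]
      exact hf.add hg
  exact stronglyMeasurable_of_tendsto Filter.atTop (fun n => simple (hf.approx n))
    (tendsto_pi_nhds.2 fun s => ((T s).continuous.tendsto _).comp (hf.tendsto_approx s))

variable {A : Type*} [NonUnitalCStarAlgebra A]

theorem stronglyMeasurable_aut_apply {β : S → (A ≃⋆ₐ[ℂ] A)}
    (hβ : ∀ a, StronglyMeasurable fun s => β s a) {f : S → A} (hf : StronglyMeasurable f) :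
    StronglyMeasurable fun s => β s (f s) :=
  stronglyMeasurable_apply (T := fun s => autCLM (β s)) hβ hf

namespace StrictlyMeasurable

variable {u w : S → unitary 𝓜(ℂ, A)}

theorem fst_apply (hu : StrictlyMeasurable u) {f : S → A} (hf : StronglyMeasurable f) :
    StronglyMeasurable fun s => (u s : 𝓜(ℂ, A)).fst (f s) :=
  stronglyMeasurable_apply (fun a => (hu a).1) hf

theorem snd_apply (hu : StrictlyMeasurable u) {f : S → A} (hf : StronglyMeasurable f) :
    StronglyMeasurable fun s => (u s : 𝓜(ℂ, A)).snd (f s) :=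
  stronglyMeasurable_apply (fun a => (hu a).2) hf

theorem const (u : unitary 𝓜(ℂ, A)) : StrictlyMeasurable fun _ : S => u :=
  fun _ => ⟨stronglyMeasurable_const, stronglyMeasurable_const⟩

theorem mul (hu : StrictlyMeasurable u) (hw : StrictlyMeasurable w) :
    StrictlyMeasurable fun s => u s * w s :=
  fun a => ⟨hu.fst_apply (hw a).1, hw.snd_apply (hu a).2⟩

theorem inv (hu : StrictlyMeasurable u) : StrictlyMeasurable fun s => (u s)⁻¹ := by
  refine fun a => ⟨?_, ?_⟩
  · simp only [coe_inv_eq_star, DoubleCentralizer.star_fst]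
    exact (hu _).2.star
  · simp only [coe_inv_eq_star, DoubleCentralizer.star_snd]
    exact (hu _).1.star

theorem comp (hu : StrictlyMeasurable u) {R : Type*} [MeasurableSpace R] {g : R → S}
    (hg : Measurable g) : StrictlyMeasurable fun r => u (g r) :=
  fun a => ⟨(hu a).1.comp_measurable hg, (hu a).2.comp_measurable hg⟩

theorem scalar {c : S → Circle} (hc : Measurable fun s => (c s : ℂ)) :
    StrictlyMeasurable fun s => (scalar (c s) : unitary 𝓜(ℂ, A)) := by
  have h : ∀ a : A, StronglyMeasurable fun s => (c s : ℂ) • a :=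
    fun a => hc.stronglyMeasurable.smul_const a
  exact fun a => ⟨h a, h a⟩

theorem ad_apply (hu : StrictlyMeasurable u) {f : S → A} (hf : StronglyMeasurable f) :
    StronglyMeasurable fun s => ad (u s) (f s) :=
  hu.fst_apply (hu.inv.snd_apply hf)

theorem onUnitary (hu : StrictlyMeasurable u) {β : S → (A ≃⋆ₐ[ℂ] A)}
    (hβ : ∀ a, StronglyMeasurable fun s => β s a)
    (hβ' : ∀ a, StronglyMeasurable fun s => (β s).symm a) :
    StrictlyMeasurable fun s => onUnitary (β s) (u s) :=
  fun a => ⟨stronglyMeasurable_aut_apply hβ (hu.fst_apply (hβ' a)),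
    stronglyMeasurable_aut_apply hβ (hu.snd_apply (hβ' a))⟩

end StrictlyMeasurable

end Measurability

/-! ### Exterior equivalence of twisted actions -/

namespace IsTwistedAction

variable {G A : Type*} [CommGroup G] [MeasurableSpace G] [NonUnitalCStarAlgebra A]
  {β : G → (A ≃⋆ₐ[ℂ] A)} {v : G → G → unitary 𝓜(ℂ, A)} {φ : G → G → G → Circle}

theorem onUnitary_comp (h : IsTwistedAction β v φ) (x y : G) (m : unitary 𝓜(ℂ, A)) :
    onUnitary (β x) (onUnitary (β y) m) = v x y * onUnitary (β (x * y)) m * (v x y)⁻¹ := by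
  rw [← onUnitary_mul_aut, h.comp, onUnitary_mul_aut, onUnitary_ad]

theorem cocycle_eq (h : IsTwistedAction β v φ) (x y z : G) :
    v x y * v (x * y) z = scalar (φ x y z) * (onUnitary (β x) (v y z) * v x (y * z)) :=
  eq_scalar_mul_iff.1 (h.cocycle x y z)

theorem action_one (h : IsTwistedAction β v φ) : β 1 = ad (v 1 1) := by
  have := h.comp 1 1
  rw [mul_one] at this
  exact mul_right_cancel this

theorem inv_action (h : IsTwistedAction β v φ) (x : G) :
    (β x)⁻¹ = β x⁻¹ * ad (v 1 1)⁻¹ * ad (v x x⁻¹)⁻¹ := by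
  rw [inv_eq_iff_mul_eq_one, ← mul_assoc, ← mul_assoc, h.comp, mul_inv_cancel, h.action_one,
    mul_assoc (ad (v x x⁻¹)), ← ad_mul, mul_inv_cancel, ad_one, mul_one, ← ad_mul, mul_inv_cancel,
    ad_one]

/-- Measurability of the pointwise inverses is not part of the definition; it follows because
`β_x⁻¹` is `β` at `x⁻¹` up to inner automorphisms depending measurably on `x`. -/
theorem measurable_symm [MeasurableInv G] (h : IsTwistedAction β v φ) (a : A) :
    StronglyMeasurable fun x => (β x).symm a := by
  have key : (fun x => (β x).symm a) =
      fun x => β x⁻¹ (ad (v 1 1)⁻¹ (ad (v x x⁻¹)⁻¹ a)) := by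
    funext x
    exact DFunLike.congr_fun (h.inv_action x) a
  have hv : StrictlyMeasurable fun x => (v x x⁻¹)⁻¹ :=
    (h.measurable_twist.comp (g := fun x => (x, x⁻¹)) (by fun_prop)).inv
  rw [key]
  exact stronglyMeasurable_aut_apply
    (fun b => (h.measurable_action b).comp_measurable measurable_inv)
    ((StrictlyMeasurable.const (v 1 1)⁻¹).ad_apply (hv.ad_apply stronglyMeasurable_const))

/-- Changing a twisted action by unitaries `w` and scalars `c` multiplies its three-cocycle by the
coboundary of `c`. -/
theorem exterior [MeasurableInv G] [MeasurableMul₂ G] (h : IsTwistedAction β v φ)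
    {w : G → unitary 𝓜(ℂ, A)} (hw : StrictlyMeasurable w) {c : G → G → Circle}
    (hc : Measurable fun p : G × G => (c p.1 p.2 : ℂ)) {β' : G → (A ≃⋆ₐ[ℂ] A)}
    {v' : G → G → unitary 𝓜(ℂ, A)} {φ' : G → G → G → Circle} (hβ' : ∀ x, β' x = ad (w x) * β x)
    (hv' : ∀ x y, v' x y =
      scalar (c x y) * (w x * onUnitary (β x) (w y) * v x y * (w (x * y))⁻¹))
    (hφ' : ∀ x y z, φ' x y z = φ x y z * coboundary c x y z) :
    IsTwistedAction β' v' φ' where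
  measurable_action a := by
    simp only [hβ']
    exact hw.ad_apply (h.measurable_action a)
  measurable_twist := by
    simp only [hv']
    refine (StrictlyMeasurable.scalar hc).mul (StrictlyMeasurable.mul (StrictlyMeasurable.mul
      (StrictlyMeasurable.mul (hw.comp measurable_fst) ?_) h.measurable_twist)
      (hw.comp (measurable_fst.mul measurable_snd)).inv)
    exact (hw.comp measurable_snd).onUnitary
      (fun a => (h.measurable_action a).comp_measurable measurable_fst)
      (fun a => (h.measurable_symm a).comp_measurable measurable_fst)
  comp x y := by
    rw [hβ', hβ', hβ', hv', ad_mul, ad_scalar, one_mul, ← mul_assoc (ad _) (ad _), ← ad_mul,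
      inv_mul_cancel_right, ad_mul, mul_assoc _ _ (β _), ← h.comp, ad_mul, mul_assoc (ad (w x)),
      ← mul_assoc (β x), aut_mul_ad]
    simp only [mul_assoc]
  cocycle x y z := by
    have hb : ∀ m, onUnitary (β' x) m = w x * onUnitary (β x) m * (w x)⁻¹ := fun m => by
      rw [hβ', onUnitary_mul_aut, onUnitary_ad]
    -- Moving `w z` past `v x y` makes the factors `v x y` and `v (x * y) z` adjacent, so that the
    -- old cocycle identity applies.
    have e1 : v x y * onUnitary (β (x * y)) (w z) =
        onUnitary (β x) (onUnitary (β y) (w z)) * v x y := by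
      rw [h.onUnitary_comp]; group
    have e2 : v x y * v (x * y) z = scalar (φ x y z) * (onUnitary (β x) (v y z) * v x (y * z)) :=
      h.cocycle_eq x y z
    rw [eq_scalar_mul_iff, hv' x y, hv' (x * y) z, hb, hv' y z, hv' x (y * z), hφ']
    have hs : φ x y z * coboundary c x y z * (c y z * c x (y * z)) =
        c x y * c (x * y) z * φ x y z := by
      rw [coboundary, mul_comm (c y z), mul_assoc, div_mul_cancel, mul_comm]
    calc _ = scalar (c x y * c (x * y) z) * (w x * onUnitary (β x) (w y) *
          (v x y * onUnitary (β (x * y)) (w z)) * v (x * y) z * (w (x * y * z))⁻¹) := by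
            rw [scalar_mul_mul_scalar_mul]
            group
      _ = scalar (c x y * c (x * y) z) * (w x * onUnitary (β x) (w y) *
          onUnitary (β x) (onUnitary (β y) (w z)) * (v x y * v (x * y) z) *
            (w (x * y * z))⁻¹) := by rw [e1]; group
      _ = scalar (c x y * c (x * y) z * φ x y z) * (w x * onUnitary (β x) (w y) *
          onUnitary (β x) (onUnitary (β y) (w z)) * (onUnitary (β x) (v y z) * v x (y * z)) *
            (w (x * y * z))⁻¹) := by
            rw [e2, mul_scalar_mul, mul_assoc (scalar _),
              map_mul _ _ (φ x y z), mul_assoc (scalar _)]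
      _ = _ := by
            rw [← hs]
            rw [map_mul (onUnitary (β x)) (scalar _), onUnitary_scalar, mul_scalar_mul _ (w x),
              mul_assoc (scalar (c y z)), scalar_mul_mul_scalar_mul]
            simp only [map_mul (onUnitary (β x)), map_inv (onUnitary (β x))]
            rw [← mul_assoc x y z, map_mul scalar _ (c y z * _), mul_assoc (scalar _) (scalar _)]
            group

end IsTwistedAction

/-! ### Square integrable functions with values in a stable C⋆-algebra -/

section L2

open scoped ENNReal ComplexConjugate

variable {T A : Type*} [MeasurableSpace T] {μ : Measure T} [NonUnitalCStarAlgebra A]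

variable (μ A) in
/-- The `A`-valued inner product `∫ g(t)⋆ h(t) dt` on `L²(T; A)`, as a real bilinear map. -/
def innerL2 : Lp A 2 μ →L[ℝ] Lp A 2 μ →L[ℝ] A :=
  ((ContinuousLinearMap.mul ℝ A).comp
    ((starL' ℝ : A ≃L[ℝ] A) : A →L[ℝ] A)).lpPairing μ 2 2

theorem innerL2_apply (g h : Lp A 2 μ) : innerL2 A μ g h = ∫ t, star (g t) * h t ∂μ :=
  ContinuousLinearMap.lpPairing_eq_integral _ _ _

variable (μ A) in
/-- The function `t ↦ f(t) a` in `L²(T; A)`, for `f` in `L²(T)` and `a` in `A`. -/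
def tensorL2 : Lp ℂ 2 μ →L[ℂ] A →L[ℂ] Lp A 2 μ :=
  LinearMap.mkContinuous₂
    (LinearMap.mk₂ ℂ (fun f a => (ContinuousLinearMap.toSpanSingleton ℂ a).compLpL 2 μ f)
      (fun f g a => map_add _ f g) (fun c f a => map_smul _ c f)
      (fun f a b => by
        rw [ContinuousLinearMap.toSpanSingleton_add, ContinuousLinearMap.add_compLpL]; rfl)
      (fun c f a => by
        rw [ContinuousLinearMap.toSpanSingleton_smul, ContinuousLinearMap.smul_compLpL]; rfl))
    1 (fun f a => by
      refine (ContinuousLinearMap.norm_compLp_le _ _).trans ?_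
      rw [ContinuousLinearMap.norm_toSpanSingleton, one_mul, mul_comm])

theorem tensorL2_coeFn (f : Lp ℂ 2 μ) (a : A) :
    tensorL2 A μ f a =ᵐ[μ] fun t => f t • a :=
  (ContinuousLinearMap.toSpanSingleton ℂ a).coeFn_compLp f

theorem innerL2_tensorL2 (f g : Lp ℂ 2 μ) (a b : A) :
    innerL2 A μ (tensorL2 A μ f a) (tensorL2 A μ g b) = inner ℂ f g • (star a * b) := by
  rw [innerL2_apply, L2.inner_def, ← integral_smul_const]
  refine integral_congr_ae ?_
  filter_upwards [tensorL2_coeFn f a, tensorL2_coeFn g b] with t hf hg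
  rw [hf, hg, star_smul, smul_mul_smul_comm, RCLike.inner_apply', RCLike.star_def]

/-- Distinct orthonormal vectors are at distance √2, so balls of radius 1/2 around them are
disjoint. -/
theorem countable_of_orthonormal {ι E : Type*} [NormedAddCommGroup E] [InnerProductSpace ℂ E]
    [TopologicalSpace.SeparableSpace E] {b : ι → E} (hb : Orthonormal ℂ b) : Countable ι := by
  refine Pairwise.countable_of_isOpen_disjoint (s := fun i => Metric.ball (b i) (1 / 2)) ?_
    (fun i => Metric.isOpen_ball) (fun i => ⟨b i, Metric.mem_ball_self (by norm_num)⟩)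
  intro i j hij
  refine Metric.ball_disjoint_ball ?_
  have h : ‖b i - b j‖ ^ 2 = 2 := by
    rw [@norm_sub_sq ℂ, hb.1, hb.1, hb.2 hij]
    norm_num
  rw [dist_eq_norm]
  nlinarith [norm_nonneg (b i - b j)]

/-- An indicator function times a constant is an elementary tensor, and these span a dense subspace.
-/
theorem dense_of_tensorL2 {K : Submodule ℂ (Lp A 2 μ)} (hK : IsClosed (K : Set (Lp A 2 μ)))
    (h : ∀ f a, tensorL2 A μ f a ∈ K) (g : Lp A 2 μ) : g ∈ K := by
  refine Lp.induction (by norm_num) (fun g => g ∈ K) ?_ (fun f g hf hg _ => K.add_mem) hK g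
  intro c s hs hμs
  have : ((Lp.simpleFunc.indicatorConst 2 hs hμs.ne c : Lp.simpleFunc A 2 μ) : Lp A 2 μ) =
      tensorL2 A μ (indicatorConstLp 2 hs hμs.ne (1 : ℂ)) c := by
    rw [Lp.simpleFunc.coe_indicatorConst]
    refine Lp.ext ?_
    filter_upwards [tensorL2_coeFn (indicatorConstLp 2 hs hμs.ne (1 : ℂ)) c,
      indicatorConstLp_coeFn (p := 2) (hs := hs) (hμs := hμs.ne) (c := c),
      indicatorConstLp_coeFn (p := 2) (hs := hs) (hμs := hμs.ne) (c := (1 : ℂ))] with t h1 h2 h3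
    rw [h1, h2, h3]
    by_cases ht : t ∈ s <;> simp [ht]
  rw [this]
  exact h _ _

/-- For stable `A`, the Hilbert `A`-module `L²(T; A)` is isomorphic to `A`. -/
theorem exists_unitary_of_isStable (hA : IsStable A) [MeasurableSpace.CountablyGenerated T]
    [SigmaFinite μ] [Nontrivial (Lp ℂ 2 μ)] :
    ∃ U : Lp A 2 μ →L[ℂ] A, DenseRange U ∧ ∀ g h, star (U g) * U h = innerL2 A μ g h := by
  classical
  obtain ⟨e, emul, estar, -, edense⟩ := hA
  obtain ⟨κ, b, -⟩ := exists_hilbertBasis ℂ (Lp ℂ 2 μ)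
  have : Fact ((2 : ℝ≥0∞) ≠ ∞) := ⟨by norm_num⟩
  have hcount : Countable κ := countable_of_orthonormal b.orthonormal
  have hne : Nonempty κ := by
    by_contra hκ
    rw [not_nonempty_iff] at hκ
    have := b.dense_span
    rw [Set.range_eq_empty, Submodule.span_empty,
      IsClosed.submodule_topologicalClosure_eq isClosed_singleton] at this
    exact bot_ne_top this
  -- `U` will send `b_k ⊗ e_{ij}(a)` to `e_{σ(k,i),j}(a)`: the index of the Hilbert basis is
  -- absorbed into the row index of the matrix units.
  obtain ⟨σ⟩ : Nonempty (κ × ℕ ≃ ℕ) := nonempty_equiv_of_countable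
  let F : (κ × ℕ × ℕ →₀ A) →ₗ[ℂ] A :=
    Finsupp.lsum ℂ fun p => e (σ (p.1, p.2.1)) p.2.2
  let E : (κ × ℕ × ℕ →₀ A) →ₗ[ℂ] Lp A 2 μ :=
    Finsupp.lsum ℂ fun p => (tensorL2 A μ (b p.1) : A →ₗ[ℂ] Lp A 2 μ) ∘ₗ e p.2.1 p.2.2
  have hF : ∀ p a, F (Finsupp.single p a) = e (σ (p.1, p.2.1)) p.2.2 a := fun p a => by
    simp [F]
  have hE : ∀ p a, E (Finsupp.single p a) = tensorL2 A μ (b p.1) (e p.2.1 p.2.2 a) := fun p a => by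
    simp [E]
  have hEF : ∀ x y, star (F x) * F y = innerL2 A μ (E x) (E y) := by
    intro x y
    induction x using Finsupp.induction_linear with
    | zero => simp
    | add x x' hx hx' => rw [map_add, map_add, map_add, star_add, add_mul, hx, hx']; rfl
    | single p a =>
      induction y using Finsupp.induction_linear with
      | zero => simp
      | add y y' hy hy' => rw [map_add, map_add, map_add, mul_add, hy, hy']
      | single q c =>
        rw [hF, hF, hE, hE, innerL2_tensorL2, estar, estar, emul, emul,
          orthonormal_iff_ite.1 b.orthonormal]
        by_cases h1 : p.1 = q.1
        · by_cases h2 : p.2.1 = q.2.1 <;> simp [h1, h2]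
        · simp [h1]
  -- The C⋆-identity gives `‖F x‖² = ‖⟨E x, E x⟩‖`, which is bounded by the norm of the pairing.
  -- This makes `F` factor through `E` and extend by continuity.
  have hbound : ∃ C, ∀ x, ‖F x‖ ≤ C * ‖E x‖ := by
    refine ⟨√‖innerL2 A μ‖, fun x => ?_⟩
    rw [← abs_of_nonneg (norm_nonneg (F x)), ← abs_of_nonneg (norm_nonneg (E x))]
    rw [← Real.sqrt_sq_eq_abs, ← Real.sqrt_sq_eq_abs, ← Real.sqrt_mul (norm_nonneg (innerL2 A μ))]
    refine Real.sqrt_le_sqrt ?_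
    rw [sq, ← CStarRing.norm_star_mul_self, hEF, sq, ← mul_assoc]
    exact (innerL2 A μ).le_opNorm₂ _ _
  have hdense : DenseRange E := by
    let K := (LinearMap.range E).topologicalClosure
    have hK : IsClosed (K : Set (Lp A 2 μ)) := Submodule.isClosed_topologicalClosure _
    have h1 : ∀ k a, tensorL2 A μ (b k) a ∈ K := by
      intro k a
      refine edense.induction (P := fun a => tensorL2 A μ (b k) a ∈ K) ?_
        (hK.preimage (tensorL2 A μ (b k)).continuous) a
      intro a ha
      have hle : (⨆ i, ⨆ j, LinearMap.range (e i j)) ≤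
          K.comap (tensorL2 A μ (b k) : A →ₗ[ℂ] Lp A 2 μ) := by
        refine iSup_le fun i => iSup_le fun j => ?_
        rintro _ ⟨c, rfl⟩
        exact (LinearMap.range E).le_topologicalClosure ⟨Finsupp.single (k, i, j) c, hE _ _⟩
      exact hle ha
    have h2 : ∀ f a, tensorL2 A μ f a ∈ K := by
      intro f a
      have hle : (Submodule.span ℂ (Set.range b)).topologicalClosure ≤
          K.comap (((tensorL2 A μ).flip a : Lp ℂ 2 μ →L[ℂ] Lp A 2 μ) :
            Lp ℂ 2 μ →ₗ[ℂ] Lp A 2 μ) := by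
        refine Submodule.topologicalClosure_minimal _ ?_
          (hK.preimage ((tensorL2 A μ).flip a).continuous)
        rw [Submodule.span_le]
        rintro _ ⟨k, rfl⟩
        exact h1 k a
      exact hle (by rw [b.dense_span]; trivial)
    intro g
    exact dense_of_tensorL2 hK h2 g
  let U : Lp A 2 μ →L[ℂ] A := F.extendOfNorm E
  have hU : ∀ x, U (E x) = F x := LinearMap.extendOfNorm_eq hdense hbound
  refine ⟨U, ?_, fun g h => ?_⟩
  · refine edense.mono ?_
    have hle : (⨆ i, ⨆ j, LinearMap.range (e i j)) ≤ LinearMap.range (U : Lp A 2 μ →ₗ[ℂ] A) := by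
      refine iSup_le fun i => iSup_le fun j => ?_
      rintro _ ⟨c, rfl⟩
      refine ⟨E (Finsupp.single ((σ.symm i).1, (σ.symm i).2, j) c), ?_⟩
      rw [ContinuousLinearMap.coe_coe, hU, hF, Prod.mk.eta, Equiv.apply_symm_apply]
    exact hle
  · refine hdense.induction_on₂ (p := fun g h => star (U g) * U h = innerL2 A μ g h) ?_ ?_ g h
    · exact isClosed_eq (by fun_prop) (by fun_prop)
    · intro x y
      rw [hU, hU, hEF]

end L2

/-! ### Measurability of maps into `L²(T; A)` -/

section L2Measurable

open scoped ENNReal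

variable {X T A : Type*} [MeasurableSpace X] [MeasurableSpace T] {μ : Measure T}
  [NonUnitalCStarAlgebra A] [MeasurableSpace.CountablyGenerated T] [SigmaFinite μ]

/-- The coefficients in a countable orthonormal basis are parameter integrals, hence measurable, and
the basis expansion is a pointwise limit of finite sums. -/
theorem stronglyMeasurable_toLp_complex {f : X × T → ℂ} (hf : StronglyMeasurable f)
    (h : ∀ x, MemLp (fun t => f (x, t)) 2 μ) : StronglyMeasurable fun x => (h x).toLp := by
  obtain ⟨κ, b, -⟩ := exists_hilbertBasis ℂ (Lp ℂ 2 μ)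
  have : Fact ((2 : ℝ≥0∞) ≠ ∞) := ⟨by norm_num⟩
  have hcount : Countable κ := countable_of_orthonormal b.orthonormal
  have hrepr : ∀ k, StronglyMeasurable fun x => b.repr (h x).toLp k := by
    intro k
    have : (fun x => b.repr (h x).toLp k) = fun x => ∫ t, star (b k t) * f (x, t) ∂μ := by
      funext x
      rw [b.repr_apply_apply, L2.inner_def]
      refine integral_congr_ae ?_
      filter_upwards [(h x).coeFn_toLp] with t ht
      rw [ht, RCLike.inner_apply', RCLike.star_def]
    rw [this]
    exact (((Lp.stronglyMeasurable (b k)).comp_measurable measurable_snd).star.mul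
      hf).integral_prod_right'
  exact stronglyMeasurable_of_tendsto (Filter.atTop : Filter (Finset κ))
    (fun s => Finset.stronglyMeasurable_fun_sum s fun k _ => (hrepr k).smul_const (b k))
    (tendsto_pi_nhds.2 fun x => b.hasSum_repr _)

theorem stronglyMeasurable_toLp_simpleFunc (f : SimpleFunc (X × T) A)
    (h : ∀ x, MemLp (fun t => f (x, t)) 2 μ) : StronglyMeasurable fun x => (h x).toLp := by
  induction f using SimpleFunc.induction with
  | @const c s hs =>
    -- For `c = 0` the slices of `s` may have infinite measure, so the indicator need not be square
    -- integrable.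
    by_cases hc : c = 0
    · have : (fun x => (h x).toLp) = fun _ => 0 := by
        funext x
        refine (MemLp.toLp_eq_toLp_iff (h x) MemLp.zero).2 (.of_forall fun t => ?_)
        simp [hc]
      rw [this]
      exact stronglyMeasurable_const
    · have hm : StronglyMeasurable (s.indicator fun _ : X × T => (1 : ℂ)) :=
        stronglyMeasurable_const.indicator hs
      have h1 : ∀ x, MemLp (fun t => s.indicator (fun _ : X × T => (1 : ℂ)) (x, t)) 2 μ := by
        refine fun x => MemLp.of_le_mul (c := ‖c‖⁻¹) (h x)
          (hm.comp_measurable measurable_prodMk_left).aestronglyMeasurable (.of_forall fun t => ?_)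
        classical
        by_cases ht : (x, t) ∈ s <;> simp [ht, hc]
      have : (fun x => (h x).toLp) = fun x => tensorL2 A μ (h1 x).toLp c := by
        funext x
        refine Lp.ext ?_
        filter_upwards [(h x).coeFn_toLp, (h1 x).coeFn_toLp, tensorL2_coeFn (h1 x).toLp c]
          with t e1 e2 e3
        rw [e1, e3, e2]
        classical
        by_cases ht : (x, t) ∈ s <;> simp [ht]
      rw [this]
      exact ((tensorL2 A μ).flip c).continuous.comp_stronglyMeasurable
        (stronglyMeasurable_toLp_complex hm h1)
  | @add f g hd hf hg =>
    -- Disjointness of the supports lets each summand inherit square integrability from the sum.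
    have hle : ∀ p, ‖f p‖ ≤ ‖(f + g) p‖ ∧ ‖g p‖ ≤ ‖(f + g) p‖ := by
      intro p
      by_cases hp : p ∈ Function.support f
      · have : g p = 0 := by simpa using Set.disjoint_left.1 hd hp
        simp [this]
      · have : f p = 0 := by simpa using hp
        simp [this]
    have h1 : ∀ x, MemLp (fun t => f (x, t)) 2 μ := fun x => (h x).of_le
      (f.stronglyMeasurable.comp_measurable measurable_prodMk_left).aestronglyMeasurable
      (.of_forall fun t => (hle _).1)
    have h2 : ∀ x, MemLp (fun t => g (x, t)) 2 μ := fun x => (h x).of_le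
      (g.stronglyMeasurable.comp_measurable measurable_prodMk_left).aestronglyMeasurable
      (.of_forall fun t => (hle _).2)
    exact (hf h1).add (hg h2)

/-- A jointly measurable family of square integrable functions is measurable as a map
to `L²(T; A)`. -/
theorem stronglyMeasurable_toLp {f : X × T → A} (hf : StronglyMeasurable f)
    (h : ∀ x, MemLp (fun t => f (x, t)) 2 μ) : StronglyMeasurable fun x => (h x).toLp := by
  borelize A
  have hsep : TopologicalSpace.SeparableSpace (Set.range f ∪ {0} : Set A) :=
    hf.separableSpace_range_union_singleton
  have h0 : (0 : A) ∈ Set.range f ∪ {0} := by simp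
  -- `A` itself need not be separable, so the approximants take values in the separable set formed
  -- by the range of `f` and 0.
  let F : ℕ → SimpleFunc (X × T) A := SimpleFunc.approxOn f hf.measurable (Set.range f ∪ {0}) 0 h0
  have hfx : ∀ x, Measurable fun t => f (x, t) := fun x =>
    hf.measurable.comp measurable_prodMk_left
  have hF : ∀ n x, MemLp (fun t => F n (x, t)) 2 μ := fun n x =>
    SimpleFunc.memLp_approxOn (hfx x) (h x) h0 MemLp.zero n
  refine stronglyMeasurable_of_tendsto Filter.atTop
    (fun n => stronglyMeasurable_toLp_simpleFunc (F n) (hF n)) (tendsto_pi_nhds.2 fun x => ?_)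
  refine (Lp.tendsto_Lp_iff_tendsto_eLpNorm'' _ (fun n => hF n x) _ (h x)).2 ?_
  refine SimpleFunc.tendsto_approxOn_Lp_eLpNorm (hfx x) h0 (by norm_num)
    (.of_forall fun t => subset_closure (by simp)) ?_
  simpa using (h x).eLpNorm_lt_top

end L2Measurable

/-! ### Maps of `A` compatible with the inner product `a⋆ b` -/

section Isometries

variable {A : Type*} [NonUnitalCStarAlgebra A]

/-- A surjective linear map on `A` preserving `a⋆ b` is given by a unitary multiplier. -/
theorem exists_unitary_fst_eq {T : A →L[ℂ] A} (hT : ∀ a b, star (T a) * T b = star a * b)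
    (hs : Function.Surjective T) :
    ∃ u : unitary 𝓜(ℂ, A), ∀ a, (u : 𝓜(ℂ, A)).fst a = T a := by
  have hn : ∀ a, ‖T a‖ = ‖a‖ := fun a => by
    rw [← mul_self_inj (norm_nonneg _) (norm_nonneg _), ← CStarRing.norm_star_mul_self, hT,
      CStarRing.norm_star_mul_self]
  let e : A ≃ₗᵢ[ℂ] A := LinearIsometryEquiv.ofSurjective ⟨T, hn⟩ hs
  have he : ∀ a, T (e.symm a) = a := e.apply_symm_apply
  have he' : ∀ a, e.symm (T a) = a := e.symm_apply_apply
  -- The right action is forced: `a u = (u⁻¹ a⋆)⋆`.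
  let S : A →L[ℂ] A :=
    { toFun := fun a => star (e.symm (star a))
      map_add' := fun a b => by simp
      map_smul' := fun c a => by simp
      cont := by fun_prop }
  let m : 𝓜(ℂ, A) :=
    { fst := T
      snd := S
      central := fun a b => by
        change star (e.symm (star a)) * b = a * T b
        rw [← hT, he, star_star] }
  refine ⟨⟨m, Unitary.mem_iff.2 ⟨multiplier_ext fun a => ?_, multiplier_ext fun a => ?_⟩⟩,
    fun a => rfl⟩
  · change star (star (e.symm (star (star (T a))))) = a
    rw [star_star, star_star, he']
  · change T (star (star (e.symm (star (star a))))) = a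
    rw [star_star, star_star, he]

/-- A map `Y` with `Y(a)⋆ Y(b) = β(a⋆ b)` is compatible with right multiplication. -/
theorem map_snd_of_star_mul {Y : A → A} {β : A ≃⋆ₐ[ℂ] A}
    (hY : ∀ a b, star (Y a) * Y b = β (star a * b)) (u : unitary 𝓜(ℂ, A)) (a : A) :
    Y ((u : 𝓜(ℂ, A)).snd a) = (onUnitary β u : 𝓜(ℂ, A)).snd (Y a) := by
  set p := Y ((u : 𝓜(ℂ, A)).snd a)
  set q := (onUnitary β u : 𝓜(ℂ, A)).snd (Y a)
  -- `Y` need not be onto, so orthogonality of `p - q` to its range is not enough; orthogonality to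
  -- `q`, which may lie outside the range, is checked separately.
  have h : ∀ c, star (Y c) * (p - q) = 0 := fun c => by
    rw [mul_sub, hY, ← snd_mul, map_snd, ← hY, snd_mul, sub_self]
  have hq : star q * (p - q) = 0 := by
    have : star q = (star (onUnitary β u : 𝓜(ℂ, A))).fst (star (Y a)) := by
      rw [DoubleCentralizer.star_fst, star_star]
    rw [this, ← fst_mul, h, map_zero]
  have : star (p - q) * (p - q) = 0 := by
    rw [star_sub, sub_mul, h, hq, sub_zero]
  exact sub_eq_zero.1 (CStarRing.star_mul_self_eq_zero_iff _ |>.1 this)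

/-- Invertibility of the map is what allows `f` to be arbitrary, without integrability; the same
holds for `integral_snd`. -/
theorem integral_aut {T : Type*} [MeasurableSpace T] (μ : Measure T) (β : A ≃⋆ₐ[ℂ] A)
    (f : T → A) : ∫ t, β (f t) ∂μ = β (∫ t, f t ∂μ) :=
  (ContinuousLinearEquiv.equivOfInverse (autCLM β) (autCLM β.symm) β.symm_apply_apply
    β.apply_symm_apply).integral_comp_comm f

theorem integral_snd {T : Type*} [MeasurableSpace T] (μ : Measure T) (u : unitary 𝓜(ℂ, A))
    (f : T → A) : ∫ t, (u : 𝓜(ℂ, A)).snd (f t) ∂μ = (u : 𝓜(ℂ, A)).snd (∫ t, f t ∂μ) :=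
  (ContinuousLinearEquiv.equivOfInverse (u : 𝓜(ℂ, A)).snd (star (u : 𝓜(ℂ, A))).snd
    (snd_mul_star_cancel u) (snd_star_mul_cancel u)).integral_comp_comm f

end Isometries

/-! ### Weighted composition operators on `L²(T; A)` -/

section WeightedComposition

variable {T A : Type*} [MeasurableSpace T] {μ : Measure T} [NonUnitalCStarAlgebra A]
  {L : T → A →L[ℂ] A} {τ : T → T}

theorem memLp_weightedComp (hL : ∀ a, StronglyMeasurable fun t => L t a)
    (hn : ∀ t a, ‖L t a‖ ≤ ‖a‖) (hτ : MeasurePreserving τ μ μ) (g : Lp A 2 μ) :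
    MemLp (fun t => L t (g (τ t))) 2 μ :=
  ((Lp.memLp g).comp_measurePreserving hτ).of_le
    (stronglyMeasurable_apply hL
      ((Lp.stronglyMeasurable g).comp_measurable hτ.measurable)).aestronglyMeasurable
    (.of_forall fun _ => hn _ _)

/-- The operator `g ↦ (t ↦ L_t g(τ(t)))` on `L²(T; A)`. -/
def weightedComp (hL : ∀ a, StronglyMeasurable fun t => L t a)
    (hn : ∀ t a, ‖L t a‖ ≤ ‖a‖) (hτ : MeasurePreserving τ μ μ) : Lp A 2 μ →ₗ[ℂ] Lp A 2 μ where
  toFun g := (memLp_weightedComp hL hn hτ g).toLp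
  map_add' g h := by
    rw [← MemLp.toLp_add]
    refine (MemLp.toLp_eq_toLp_iff _ _).2 ?_
    filter_upwards [hτ.quasiMeasurePreserving.ae_eq_comp (Lp.coeFn_add g h)] with t ht
    simp only [Function.comp_apply, Pi.add_apply] at ht ⊢
    rw [ht, map_add]
  map_smul' c g := by
    rw [RingHom.id_apply, ← MemLp.toLp_const_smul]
    refine (MemLp.toLp_eq_toLp_iff _ _).2 ?_
    filter_upwards [hτ.quasiMeasurePreserving.ae_eq_comp (Lp.coeFn_smul c g)] with t ht
    simp only [Function.comp_apply, Pi.smul_apply] at ht ⊢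
    rw [ht, map_smul]

theorem weightedComp_coeFn (hL : ∀ a, StronglyMeasurable fun t => L t a)
    (hn : ∀ t a, ‖L t a‖ ≤ ‖a‖) (hτ : MeasurePreserving τ μ μ) (g : Lp A 2 μ) :
    weightedComp hL hn hτ g =ᵐ[μ] fun t => L t (g (τ t)) :=
  (memLp_weightedComp hL hn hτ g).coeFn_toLp

end WeightedComposition

/-! ### Untwisting actions on stable C⋆-algebras -/

section Untwisting

/-- A compact neighbourhood of 1 has positive finite measure. Nontriviality makes the Hilbert basis
used for `U` nonempty. -/
theorem nontrivial_L2_haar {G : Type*} [Group G] [TopologicalSpace G] [IsTopologicalGroup G]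
    [T2Space G] [LocallyCompactSpace G] [MeasurableSpace G] [BorelSpace G] :
    Nontrivial (Lp ℂ 2 (Measure.haar : Measure G)) := by
  obtain ⟨K, hK, hK1⟩ := exists_compact_mem_nhds (1 : G)
  have hfin : Measure.haar K ≠ ⊤ := hK.measure_lt_top.ne
  have hpos : Measure.haar K ≠ 0 := (Measure.measure_pos_of_mem_nhds Measure.haar hK1).ne'
  refine ⟨indicatorConstLp 2 hK.measurableSet hfin (1 : ℂ), 0, fun h => ?_⟩
  have := congrArg norm h
  rw [norm_indicatorConstLp (by norm_num) (by norm_num), norm_zero, norm_one, one_mul] at this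
  exact (Real.rpow_pos_of_pos (ENNReal.toReal_pos hpos hfin) _).ne' this

variable {G A : Type*} [CommGroup G] [MeasurableSpace G] [NonUnitalCStarAlgebra A]
  {β : G → (A ≃⋆ₐ[ℂ] A)} {v : G → G → unitary 𝓜(ℂ, A)} {φ : G → G → G → Circle}

namespace IsTwistedAction

/-- The pointwise form of the composition rule for the regular representation: the cocycle identity
collapses the left factors to `v(xy,z)⁻¹`, and the `ad(v(x,y))` in `β_x β_y` leaves `v(x,y)⁻¹` on
the right. -/
theorem fst_inv_action_action (h : IsTwistedAction β v φ) (hφ : ∀ x y z, φ x y z = 1)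
    (x y z : G) (a : A) :
    (((v x (y * z))⁻¹ : unitary 𝓜(ℂ, A)) : 𝓜(ℂ, A)).fst
        (β x ((((v y z)⁻¹ : unitary 𝓜(ℂ, A)) : 𝓜(ℂ, A)).fst (β y a))) =
      (((v x y)⁻¹ : unitary 𝓜(ℂ, A)) : 𝓜(ℂ, A)).snd
        ((((v (x * y) z)⁻¹ : unitary 𝓜(ℂ, A)) : 𝓜(ℂ, A)).fst (β (x * y) a)) := by
  have hc := h.cocycle_eq x y z
  rw [hφ, map_one, one_mul] at hc
  have hu : (v x (y * z))⁻¹ * (onUnitary (β x) (v y z))⁻¹ * v x y = (v (x * y) z)⁻¹ := by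
    rw [← mul_inv_rev, ← hc, mul_inv_rev, inv_mul_cancel_right]
  have hcomp : β x (β y a) = ad (v x y) (β (x * y) a) := DFunLike.congr_fun (h.comp x y) a
  rw [map_fst, hcomp, ad_apply, map_inv, ← coe_mul_fst, ← coe_mul_fst, hu, fst_snd]
  rfl

variable [TopologicalSpace G] [IsTopologicalGroup G] [T2Space G]
    [LocallyCompactSpace G] [SecondCountableTopology G] [BorelSpace G]

/-- A family of isometries `Y_x` of `A` implementing the regular representation of a twisted
action. -/
theorem exists_regular_representation (hA : IsStable A) (h : IsTwistedAction β v φ)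
    (hφ : ∀ x y z, φ x y z = 1) :
    ∃ Y : G → A →L[ℂ] A, (∀ x a b, star (Y x a) * Y x b = β x (star a * b)) ∧
      (∀ x y a, Y x (Y y a) = (((v x y)⁻¹ : unitary 𝓜(ℂ, A)) : 𝓜(ℂ, A)).snd (Y (x * y) a)) ∧
      ∀ a, StronglyMeasurable fun x => Y x a := by
  let μ : Measure G := Measure.haar
  have : Nontrivial (Lp ℂ 2 μ) := nontrivial_L2_haar
  obtain ⟨U, hUd, hU⟩ := exists_unitary_of_isStable (μ := μ) hA
  let L : G → G → A →L[ℂ] A := fun x t =>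
    (((v x (x⁻¹ * t))⁻¹ : unitary 𝓜(ℂ, A)) : 𝓜(ℂ, A)).fst.comp (autCLM (β x))
  have hL : ∀ x a, StronglyMeasurable fun t => L x t a := fun x a =>
    ((h.measurable_twist.comp (g := fun t => (x, x⁻¹ * t)) (by fun_prop)).inv _).1
  have hn : ∀ x t a, ‖L x t a‖ ≤ ‖a‖ := fun x t a =>
    ((norm_fst_apply (v x (x⁻¹ * t))⁻¹ _).trans
      (NonUnitalStarAlgHom.norm_map (β x) (β x).injective a)).le
  have hτ : ∀ x : G, MeasurePreserving (fun t => x⁻¹ * t) μ μ := fun x =>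
    measurePreserving_mul_left μ x⁻¹
  let W : G → Lp A 2 μ →ₗ[ℂ] Lp A 2 μ := fun x => weightedComp (hL x) (hn x) (hτ x)
  have hW : ∀ x g, W x g =ᵐ[μ] fun t => L x t (g (x⁻¹ * t)) := fun x g =>
    weightedComp_coeFn (hL x) (hn x) (hτ x) g
  have hWinner : ∀ x g k, innerL2 A μ (W x g) (W x k) = β x (innerL2 A μ g k) := by
    intro x g k
    rw [innerL2_apply, innerL2_apply, ← integral_aut,
      ← integral_mul_left_eq_self (fun t => β x (star (g t) * k t)) x⁻¹]
    refine integral_congr_ae ?_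
    filter_upwards [hW x g, hW x k] with t h1 h2
    rw [h1, h2, map_mul, map_star]
    exact star_fst_mul_fst (v x (x⁻¹ * t))⁻¹ _ _
  have hUW : ∀ x g k, star (U (W x g)) * U (W x k) = β x (star (U g) * U k) := fun x g k => by
    rw [hU, hWinner, hU]
  -- `U` is only known to have dense range, so `U W_x U⁻¹` is defined by extension from that range,
  -- where it preserves the norm of `A`.
  have hbound : ∀ x, ∃ C, ∀ g, ‖((U : Lp A 2 μ →ₗ[ℂ] A) ∘ₗ W x) g‖ ≤
      C * ‖(U : Lp A 2 μ →ₗ[ℂ] A) g‖ := by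
    refine fun x => ⟨1, fun g => ?_⟩
    rw [one_mul]
    refine le_of_eq ?_
    change ‖U (W x g)‖ = ‖U g‖
    rw [← mul_self_inj (norm_nonneg _) (norm_nonneg _), ← CStarRing.norm_star_mul_self, hUW,
      NonUnitalStarAlgHom.norm_map (β x) (β x).injective, CStarRing.norm_star_mul_self]
  let Y : G → A →L[ℂ] A := fun x =>
    ((U : Lp A 2 μ →ₗ[ℂ] A) ∘ₗ W x).extendOfNorm (U : Lp A 2 μ →ₗ[ℂ] A)
  have hY : ∀ x g, Y x (U g) = U (W x g) := fun x g =>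
    LinearMap.extendOfNorm_eq (e := (U : Lp A 2 μ →ₗ[ℂ] A)) hUd (hbound x) g
  have hWW : ∀ x y g, W x (W y g) =ᵐ[μ]
      fun t => (((v x y)⁻¹ : unitary 𝓜(ℂ, A)) : 𝓜(ℂ, A)).snd (W (x * y) g t) := by
    intro x y g
    filter_upwards [hW x (W y g), hW (x * y) g,
      (hτ x).quasiMeasurePreserving.ae_eq_comp (hW y g)] with t h1 h2 h3
    simp only [Function.comp_apply] at h3
    rw [h1, h2, h3]
    have e1 : x⁻¹ * t = y * ((x * y)⁻¹ * t) := by rw [mul_inv_rev]; group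
    have e2 : y⁻¹ * (x⁻¹ * t) = (x * y)⁻¹ * t := by rw [mul_inv_rev, mul_assoc]
    have := h.fst_inv_action_action hφ x y ((x * y)⁻¹ * t) (g ((x * y)⁻¹ * t))
    rw [← e1] at this
    change (((v x (x⁻¹ * t))⁻¹ : unitary 𝓜(ℂ, A)) : 𝓜(ℂ, A)).fst (β x
      ((((v y (y⁻¹ * (x⁻¹ * t)))⁻¹ : unitary 𝓜(ℂ, A)) : 𝓜(ℂ, A)).fst
        (β y (g (y⁻¹ * (x⁻¹ * t)))))) = _
    rw [e2]
    exact this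
  refine ⟨Y, fun x a b => ?_, fun x y a => ?_, fun a => ?_⟩
  · refine hUd.induction_on₂ (p := fun a b => star (Y x a) * Y x b = β x (star a * b)) ?_ ?_ a b
    · refine isClosed_eq (by fun_prop) ((autCLM (β x)).continuous.comp (by fun_prop))
    · intro g k
      rw [hY, hY, hUW]
  · refine hUd.induction_on (p := fun a => Y x (Y y a) =
      (((v x y)⁻¹ : unitary 𝓜(ℂ, A)) : 𝓜(ℂ, A)).snd (Y (x * y) a)) a ?_ ?_
    · exact isClosed_eq (by fun_prop) (by fun_prop)
    · intro g
      rw [hY, hY, hY]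
      -- Whether `U` commutes with right multipliers is not known at this point. Pairing with the
      -- dense vectors `U k` turns the claim into an equality of integrals.
      refine eq_of_forall_mul_left fun z => ?_
      rw [← star_star z]
      refine hUd.induction_on (p := fun z => star z * U (W x (W y g)) = star z *
        (((v x y)⁻¹ : unitary 𝓜(ℂ, A)) : 𝓜(ℂ, A)).snd (U (W (x * y) g))) (star z) ?_ ?_
      · exact isClosed_eq (by fun_prop) (by fun_prop)
      · intro k
        rw [← snd_mul, hU, hU, innerL2_apply, innerL2_apply, ← integral_snd]
        refine integral_congr_ae ?_
        filter_upwards [hWW x y g] with t ht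
        rw [ht, snd_mul]
  · obtain ⟨b, hb, hba⟩ := mem_closure_iff_seq_limit.1 (hUd a)
    refine stronglyMeasurable_of_tendsto Filter.atTop (f := fun n x => Y x (b n)) (fun n => ?_)
      (tendsto_pi_nhds.2 fun x => ((Y x).continuous.tendsto a).comp hba)
    obtain ⟨g, hg⟩ := hb n
    simp only [← hg, hY]
    refine U.continuous.comp_stronglyMeasurable ?_
    have hv : StrictlyMeasurable fun p : G × G => (v p.1 (p.1⁻¹ * p.2))⁻¹ :=
      (h.measurable_twist.comp (g := fun p : G × G => (p.1, p.1⁻¹ * p.2)) (by fun_prop)).inv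
    have hf : StronglyMeasurable fun p : G × G => L p.1 p.2 (g (p.1⁻¹ * p.2)) :=
      hv.fst_apply (stronglyMeasurable_aut_apply
        (fun a => (h.measurable_action a).comp_measurable measurable_fst)
        ((Lp.stronglyMeasurable g).comp_measurable (by fun_prop)))
    exact stronglyMeasurable_toLp hf fun x => memLp_weightedComp (hL x) (hn x) (hτ x) g

/-- A twisted action with trivial three-cocycle on a stable C⋆-algebra is exterior equivalent to
an action. -/
theorem exists_untwisting (hA : IsStable A) (h : IsTwistedAction β v φ)
    (hφ : ∀ x y z, φ x y z = 1) :
    ∃ w : G → unitary 𝓜(ℂ, A), StrictlyMeasurable w ∧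
      ∀ x y, w (x * y) = w x * onUnitary (β x) (w y) * v x y := by
  obtain ⟨Y, hYs, hYY, hYm⟩ := h.exists_regular_representation hA hφ
  let T : G → A →L[ℂ] A := fun x => (Y x).comp (autCLM (β x).symm)
  have hTdef : ∀ x a, T x a = Y x ((β x).symm a) := fun _ _ => rfl
  have hTs : ∀ x a b, star (T x a) * T x b = star a * b := fun x a b => by
    rw [hTdef, hTdef, hYs, ← map_star, ← map_mul, StarAlgEquiv.apply_symm_apply]
  have hTT : ∀ x y a, T x (β x (T y ((β x).symm ((v x y : 𝓜(ℂ, A)).fst a)))) = T (x * y) a := by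
    intro x y a
    rw [hTdef, hTdef, hTdef, StarAlgEquiv.symm_apply_apply, hYY]
    set c := (β y).symm ((β x).symm ((v x y : 𝓜(ℂ, A)).fst a)) with hc
    have hcomp : β x (β y c) = ad (v x y) (β (x * y) c) := DFunLike.congr_fun (h.comp x y) c
    -- By the choice of `c`, `v a = β_x β_y(c) = v β_{xy}(c) v⁻¹` with `v = v(x,y)`; cancel `v` on
    -- the left.
    have ha : a = (((v x y)⁻¹ : unitary 𝓜(ℂ, A)) : 𝓜(ℂ, A)).snd (β (x * y) c) := by
      rw [hc, StarAlgEquiv.apply_symm_apply, StarAlgEquiv.apply_symm_apply, ← hc, ad_apply] at hcomp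
      have := congrArg (star (v x y : 𝓜(ℂ, A))).fst hcomp
      rwa [fst_star_mul_cancel, fst_star_mul_cancel] at this
    have hs := map_snd_of_star_mul (hYs (x * y)) (onUnitary (β (x * y)).symm (v x y)⁻¹) c
    rw [← onUnitary_mul_aut] at hs
    have h1 : β (x * y) * (β (x * y)).symm = 1 := mul_inv_cancel (β (x * y))
    rw [h1, onUnitary_one_aut] at hs
    rw [← hs]
    congr 1
    conv_rhs => rw [ha, map_snd, StarAlgEquiv.symm_apply_apply]
  have hinj : ∀ x, Function.Injective (T x) := fun x => by
    refine (injective_iff_map_eq_zero (T x)).2 fun a ha => ?_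
    have := hTs x a a
    rw [ha, mul_zero] at this
    exact CStarRing.star_mul_self_eq_zero_iff _ |>.1 this.symm
  -- Injectivity of `T 1` cancels the outer factor in `hTT 1 1`, exhibiting a preimage of `a`; then
  -- `hTT x x⁻¹` puts the range of `T 1` inside that of `T x`.
  have hsurj₁ : Function.Surjective (T 1) := fun a => by
    have := hTT 1 1 (β 1 a)
    rw [mul_one] at this
    exact ⟨_, (β 1).injective (hinj 1 this)⟩
  have hsurj : ∀ x, Function.Surjective (T x) := fun x a => by
    obtain ⟨b, hb⟩ := hsurj₁ a
    have := hTT x x⁻¹ b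
    rw [mul_inv_cancel, hb] at this
    exact ⟨_, this⟩
  choose w hw using fun x => exists_unitary_fst_eq (hTs x) (hsurj x)
  have hcoc : ∀ x y, w (x * y) = w x * onUnitary (β x) (w y) * v x y := fun x y =>
    unitary_ext fun a => by
      rw [coe_mul_fst, coe_mul_fst, onUnitary_fst, hw, hw, hw, hTT]
  have hTm : ∀ {f : G → A}, StronglyMeasurable f → StronglyMeasurable fun x => T x (f x) :=
    fun hf => stronglyMeasurable_apply
      (T := T)
      (fun a => stronglyMeasurable_apply (T := Y) hYm (h.measurable_symm a)) hf
  have hTm' : ∀ {f : G → A}, StronglyMeasurable f → StronglyMeasurable fun x => T x⁻¹ (f x) :=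
    fun hf => stronglyMeasurable_apply (T := fun x => T x⁻¹) (fun a =>
      (hTm (stronglyMeasurable_const (b := a))).comp_measurable measurable_inv) hf
  -- Measurability of `a w_x` amounts to that of `w_x⁻¹ a⋆`, so the inverse is expressed through `w`
  -- at `x⁻¹`, using the cocycle relation.
  have hinv : ∀ x a, (((w x)⁻¹ : unitary 𝓜(ℂ, A)) : 𝓜(ℂ, A)).fst a =
      β x (T x⁻¹ ((β x).symm ((v x x⁻¹ : 𝓜(ℂ, A)).fst
        ((((w 1)⁻¹ : unitary 𝓜(ℂ, A)) : 𝓜(ℂ, A)).fst a)))) := by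
    intro x a
    have e : (w x)⁻¹ = onUnitary (β x) (w x⁻¹) * v x x⁻¹ * (w 1)⁻¹ := by
      rw [inv_eq_iff_mul_eq_one, ← mul_assoc, ← mul_assoc, ← hcoc, mul_inv_cancel, mul_inv_cancel]
    rw [e, coe_mul_fst, coe_mul_fst, onUnitary_fst, hw]
  refine ⟨w, fun a => ⟨?_, ?_⟩, hcoc⟩
  · simp only [hw]
    exact hTm stronglyMeasurable_const
  · have hsnd : (fun x => (w x : 𝓜(ℂ, A)).snd a) =
        fun x => star (β x (T x⁻¹ ((β x).symm ((v x x⁻¹ : 𝓜(ℂ, A)).fst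
          ((((w 1)⁻¹ : unitary 𝓜(ℂ, A)) : 𝓜(ℂ, A)).fst (star a)))))) := by
      funext x
      rw [← hinv, coe_inv_eq_star, DoubleCentralizer.star_fst, star_star, star_star]
    rw [hsnd]
    have hv : StrictlyMeasurable fun x => v x x⁻¹ :=
      h.measurable_twist.comp (g := fun x => (x, x⁻¹)) (by fun_prop)
    exact (stronglyMeasurable_aut_apply h.measurable_action (hTm' (stronglyMeasurable_aut_apply
      h.measurable_symm (hv.fst_apply stronglyMeasurable_const)))).star

end IsTwistedAction

end Untwisting

/-! ### Actions of a product of two groups -/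

section Restriction

variable {G H A : Type*} [CommGroup G] [CommGroup H] [MeasurableSpace G] [MeasurableSpace H]
  [NonUnitalCStarAlgebra A] {β : G → (A ≃⋆ₐ[ℂ] A)} {v : G → G → unitary 𝓜(ℂ, A)}
  {φ : G → G → G → Circle}

/-- The restriction of a twisted action along a measurable homomorphism. -/
theorem IsTwistedAction.comp_hom (h : IsTwistedAction β v φ) (f : H →* G) (hf : Measurable f) :
    IsTwistedAction (fun x => β (f x)) (fun x y => v (f x) (f y))
      (fun x y z => φ (f x) (f y) (f z)) where
  measurable_action a := (h.measurable_action a).comp_measurable hf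
  measurable_twist := h.measurable_twist.comp (g := fun p : H × H => (f p.1, f p.2))
    ((hf.comp measurable_fst).prodMk (hf.comp measurable_snd))
  comp x y := by rw [map_mul]; exact h.comp _ _
  cocycle x y z := by
    rw [map_mul, map_mul]
    exact h.cocycle _ _ _

theorem ExteriorEquivalent.trans_upToScalars {β' β'' : G → (A ≃⋆ₐ[ℂ] A)}
    {v' v'' : G → G → unitary 𝓜(ℂ, A)} {φ'' : G → G → G → Circle}
    (h : ExteriorEquivalent β v β' v')
    (h' : ExteriorEquivalentUpToScalars β' v' φ β'' v'' φ'') :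
    ExteriorEquivalentUpToScalars β v φ β'' v'' φ'' := by
  obtain ⟨w, hw, hβ, hv⟩ := h
  obtain ⟨w', c, hw', hc, hβ', hv', hφ⟩ := h'
  refine ⟨fun x => w' x * w x, c, hw'.mul hw, hc, fun x => ?_, fun x y => ?_, hφ⟩
  · rw [hβ', hβ, ad_mul, mul_assoc]
  · rw [hv', hβ, hv, onUnitary_mul_aut, onUnitary_ad, map_mul]
    congr 2
    group

/-- The value at 1 depends on `v` alone, so untwistings chosen independently on the two factors
agree there. -/
theorem untwisting_one (h : IsTwistedAction β v φ) {w : G → unitary 𝓜(ℂ, A)}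
    (hw : ∀ x y, w (x * y) = w x * onUnitary (β x) (w y) * v x y) : w 1 = (v 1 1)⁻¹ := by
  have := hw 1 1
  rw [mul_one, h.action_one, onUnitary_ad, mul_assoc (w 1), inv_mul_cancel_right,
    left_eq_mul] at this
  exact eq_inv_of_mul_eq_one_right this

/-- Only separate continuity is given; on a second countable group it suffices for joint Borel
measurability. -/
theorem IsAntisymmTricharacter.measurable [TopologicalSpace G] [IsTopologicalGroup G] [T2Space G]
    [LocallyCompactSpace G] [SecondCountableTopology G] [BorelSpace G]
    (hφ : IsAntisymmTricharacter φ) :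
    Measurable fun p : G × G × G => (φ p.1 p.2.1 p.2.2 : ℂ) := by
  refine measurable_uncurry_of_continuous_of_measurable (ι := G)
    (u := fun x (p : G × G) => (φ x p.1 p.2 : ℂ))
    (fun p => continuous_subtype_val.comp (hφ.continuous₁ p.1 p.2)) fun x => ?_
  refine measurable_uncurry_of_continuous_of_measurable (ι := G)
    (u := fun y z => (φ x y z : ℂ))
    (fun z => continuous_subtype_val.comp (hφ.continuous₂ x z)) fun y => ?_
  exact (continuous_subtype_val.comp (hφ.continuous₃ x y)).measurable

end Restriction

/-! ### Scalar cochains attached to the tricharacter -/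

section Tricharacter

variable {G₁ G₂ : Type*} [CommGroup G₁] [CommGroup G₂] [TopologicalSpace G₁] [TopologicalSpace G₂]
  {φ : G₁ × G₂ → G₁ × G₂ → G₁ × G₂ → Circle}

theorem IsAntisymmTricharacter.cycle (hφ : IsAntisymmTricharacter φ) (ξ η ζ : G₁ × G₂) :
    φ ξ η ζ = φ η ζ ξ := by
  rw [hφ.swap₂₃ η ξ ζ, hφ.swap₁₂ ξ η ζ, inv_inv]

/-- An antisymmetric tricharacter that is trivial on `G₁` and whenever two arguments lie in `G₂` is
the product over cyclic permutations of its values with first argument in `G₂` and the others in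
`G₁`. -/
theorem IsAntisymmTricharacter.eq_cyclic (hφ : IsAntisymmTricharacter φ)
    (hφ₁ : ∀ x y z : G₁, φ (x, 1) (y, 1) (z, 1) = 1)
    (hφ₂ : ∀ (X Y : G₂) (ζ : G₁ × G₂),
      φ (1, X) (1, Y) ζ = 1 ∧ φ (1, X) ζ (1, Y) = 1 ∧ φ ζ (1, X) (1, Y) = 1)
    (ξ η ζ : G₁ × G₂) :
    φ ξ η ζ = φ (1, ξ.2) (η.1, 1) (ζ.1, 1) * φ (1, η.2) (ζ.1, 1) (ξ.1, 1) *
        φ (1, ζ.2) (ξ.1, 1) (η.1, 1) := by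
  have split : ∀ p : G₁ × G₂, p = (p.1, 1) * (1, p.2) := fun p => by simp
  conv_lhs => rw [split ξ, split η, split ζ]
  simp only [hφ.map_mul₁, hφ.map_mul₂, hφ.map_mul₃, hφ₁, fun X Y ζ => (hφ₂ X Y ζ).1,
    fun X Y ζ => (hφ₂ X Y ζ).2.1, fun X Y ζ => (hφ₂ X Y ζ).2.2, one_mul, mul_one]
  rw [hφ.cycle (ξ.1, 1) (1, η.2), ← hφ.cycle (1, ζ.2), mul_comm, mul_assoc,
    mul_comm (φ (1, ζ.2) _ _)]

variable (φ) in
/-- The scalars relating the twist `v` to `v̂`. -/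
def hatCochain (ξ η : G₁ × G₂) : Circle :=
  φ (ξ.1, 1) (η.1, 1) (1, ξ.2 * η.2) / φ (ξ.1, 1) (1, ξ.2) η

theorem hatCocycle_eq_mul_coboundary (hφ : IsAntisymmTricharacter φ)
    (hφ₁ : ∀ x y z : G₁, φ (x, 1) (y, 1) (z, 1) = 1)
    (hφ₂ : ∀ (X Y : G₂) (ζ : G₁ × G₂),
      φ (1, X) (1, Y) ζ = 1 ∧ φ (1, X) ζ (1, Y) = 1 ∧ φ ζ (1, X) (1, Y) = 1)
    (ξ η ζ : G₁ × G₂) :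
    hatCocycle φ ξ η ζ = φ ξ η ζ * coboundary (hatCochain φ) ξ η ζ := by
  let f : G₁ → G₁ → G₂ → Circle := fun x y X => φ (1, X) (x, 1) (y, 1)
  have hf : ∀ x y X, φ (1, X) (x, 1) (y, 1) = f x y X := fun _ _ _ => rfl
  have f1 : ∀ x x' y X, f (x * x') y X = f x y X * f x' y X := fun x x' y X => by
    rw [← hf, ← hf, ← hf, ← hφ.map_mul₂, Prod.mk_mul_mk, mul_one]
  have f2 : ∀ x y y' X, f x (y * y') X = f x y X * f x y' X := fun x y y' X => by
    rw [← hf, ← hf, ← hf, ← hφ.map_mul₃, Prod.mk_mul_mk, mul_one]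
  have f3 : ∀ x y X X', f x y (X * X') = f x y X * f x y X' := fun x y X X' => by
    rw [← hf, ← hf, ← hf, ← hφ.map_mul₁, Prod.mk_mul_mk, mul_one]
  have fs : ∀ x y X, f y x X = (f x y X)⁻¹ := fun x y X => hφ.swap₂₃ _ _ _
  -- One factor `f(x,y;X)` comes from the numerator `φ(x,y,XY)`, the other from inverting the
  -- denominator `φ(x,X,yY) = f(x,y;X)⁻¹`.
  have hc : ∀ ξ η, hatCochain φ ξ η = f ξ.1 η.1 ξ.2 * f ξ.1 η.1 η.2 * f ξ.1 η.1 ξ.2 := by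
    intro ξ η
    have e : φ (ξ.1, 1) (1, ξ.2) η = (f ξ.1 η.1 ξ.2)⁻¹ := by
      rw [hφ.eq_cyclic hφ₁ hφ₂, hf, hf, hf, fs ξ.1 η.1 ξ.2]
      have h1 : ∀ y z, f y z 1 = 1 := fun y z => by
        have := f3 y z 1 1
        rwa [mul_one, left_eq_mul] at this
      have h2 : ∀ x X, f x 1 X = 1 := fun x X => by
        have := f2 x 1 1 X
        rwa [mul_one, left_eq_mul] at this
      rw [h1, h2, one_mul, mul_one]
    rw [hatCochain, e, div_inv_eq_mul, ← hφ.cycle (1, _), hf, f3]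
  rw [hatCocycle, hφ.eq_cyclic hφ₁ hφ₂ ξ η ζ, coboundary, hc, hc, hc, hc]
  simp only [hf, Prod.fst_mul, Prod.snd_mul, f1, f2, f3, fs ξ.1 ζ.1 η.2]
  refine Circle.ext ?_
  push_cast
  field_simp

end Tricharacter

/-! ### Twisted actions of `G₁ × G₂` -/

section Product

variable {G₁ G₂ A : Type*} [CommGroup G₁] [CommGroup G₂] [MeasurableSpace G₁] [MeasurableSpace G₂]
  [NonUnitalCStarAlgebra A] {β : G₁ × G₂ → (A ≃⋆ₐ[ℂ] A)}
  {v : G₁ × G₂ → G₁ × G₂ → unitary 𝓜(ℂ, A)} {φ : G₁ × G₂ → G₁ × G₂ → G₁ × G₂ → Circle}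

theorem hatAction_eq (h : IsTwistedAction β v φ) (ξ : G₁ × G₂) :
    hatAction β ξ = ad (v (ξ.1, 1) (1, ξ.2)) * β ξ := by
  rw [hatAction, h.comp, Prod.mk_mul_mk, mul_one, one_mul]

/-- The numerator of `hatCochain` is the scalar in the cocycle identity at `(x, y, XY)`, the
denominator that at `(x, X, yY)`. The identities at `(X, y, Y)` and `(y, X, Y)` contribute no
scalar, having two arguments in `G₂`. -/
theorem hatTwist_eq (h : IsTwistedAction β v φ) (hv : TrivialOnFactors v)
    (hφ₂ : ∀ (X Y : G₂) (ζ : G₁ × G₂),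
      φ (1, X) (1, Y) ζ = 1 ∧ φ (1, X) ζ (1, Y) = 1 ∧ φ ζ (1, X) (1, Y) = 1) (ξ η : G₁ × G₂) :
    hatTwist β v ξ η = scalar (hatCochain φ ξ η) *
      (v (ξ.1, 1) (1, ξ.2) * onUnitary (β ξ) (v (η.1, 1) (1, η.2)) * v ξ η *
        (v ((ξ * η).1, 1) (1, (ξ * η).2))⁻¹) := by
  obtain ⟨x, X⟩ := ξ
  obtain ⟨y, Y⟩ := η
  have s1 := h.onUnitary_comp (x, 1) (1, X) (v (y, 1) (1, Y))
  have s2 := h.cocycle_eq (x, 1) (1, X) (y, Y)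
  have s3 := h.cocycle_eq (1, X) (y, 1) (1, Y)
  have s4 := h.cocycle_eq (y, 1) (1, X) (1, Y)
  have s5 := h.cocycle_eq (x, 1) (y, 1) (1, X * Y)
  rw [(hφ₂ X Y _).2.1] at s3
  rw [(hφ₂ X Y _).2.2, hv.2] at s4
  rw [hv.1] at s5
  simp only [Prod.mk_mul_mk, mul_one, one_mul, map_one] at s1 s2 s3 s4 s5
  simp only [hatTwist, hatCochain, tildeTwist, Prod.mk_mul_mk]
  set V := v (x * y, 1) (1, X * Y)
  set b := onUnitary (β (x, 1))
  have e1 : v (x, 1) (1, X) * onUnitary (β (x, X)) (v (y, 1) (1, Y)) =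
      b (onUnitary (β (1, X)) (v (y, 1) (1, Y))) * v (x, 1) (1, X) := by
    rw [s1, inv_mul_cancel_right]
  have e4 : v (y, X) (1, Y) = (v (y, 1) (1, X))⁻¹ * v (y, 1) (1, X * Y) := by
    rw [← s4, inv_mul_cancel_left]
  symm
  calc _ = scalar (φ (x, 1) (y, 1) (1, X * Y) / φ (x, 1) (1, X) (y, Y)) *
        (b (onUnitary (β (1, X)) (v (y, 1) (1, Y))) * (v (x, 1) (1, X) * v (x, X) (y, Y)) *
          V⁻¹) := by rw [e1, mul_assoc (b _)]
    _ = scalar (φ (x, 1) (y, 1) (1, X * Y)) *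
        (b (onUnitary (β (1, X)) (v (y, 1) (1, Y)) * v (1, X) (y, Y)) *
          v (x, 1) (y, X * Y) * V⁻¹) := by
          rw [s2, mul_scalar_mul, mul_assoc (scalar _), ← mul_assoc (scalar _), ← map_mul scalar,
            div_mul_cancel, map_mul b, mul_assoc (b _) (b _)]
    _ = scalar (φ (x, 1) (y, 1) (1, X * Y)) * (b (v (1, X) (y, 1) * (v (y, 1) (1, X))⁻¹) *
        (b (v (y, 1) (1, X * Y)) * v (x, 1) (y, X * Y)) * V⁻¹) := by
          rw [← s3, e4, ← mul_assoc (v (1, X) (y, 1)), map_mul b, mul_assoc (b _) (b _)]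
    _ = b (v (1, X) (y, 1) * (v (y, 1) (1, X))⁻¹) *
        (scalar (φ (x, 1) (y, 1) (1, X * Y)) *
          (b (v (y, 1) (1, X * Y)) * v (x, 1) (y, X * Y))) * V⁻¹ := by
          rw [mul_scalar_mul, mul_assoc (scalar _)]
    _ = _ := by rw [← s5, mul_inv_cancel_right]

variable [TopologicalSpace G₁] [IsTopologicalGroup G₁] [T2Space G₁]
    [LocallyCompactSpace G₁] [SecondCountableTopology G₁] [BorelSpace G₁]
    [TopologicalSpace G₂] [IsTopologicalGroup G₂] [T2Space G₂]
    [LocallyCompactSpace G₂] [SecondCountableTopology G₂] [BorelSpace G₂]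

/-- A twisted action on a stable algebra is exterior equivalent to one whose twist is trivial on
the factors, if its three-cocycle is. -/
theorem exists_trivialOnFactors (hA : IsStable A) (h : IsTwistedAction β v φ)
    (hφ₁ : ∀ x y z : G₁, φ (x, 1) (y, 1) (z, 1) = 1)
    (hφ₂ : ∀ X Y Z : G₂, φ (1, X) (1, Y) (1, Z) = 1) :
    ∃ (β' : G₁ × G₂ → (A ≃⋆ₐ[ℂ] A)) (v' : G₁ × G₂ → G₁ × G₂ → unitary 𝓜(ℂ, A)),
      IsTwistedAction β' v' φ ∧ ExteriorEquivalent β v β' v' ∧ TrivialOnFactors v' := by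
  have h₁ := h.comp_hom (MonoidHom.inl G₁ G₂) (measurable_id.prodMk measurable_const)
  have h₂ := h.comp_hom (MonoidHom.inr G₁ G₂) (measurable_const.prodMk measurable_id)
  obtain ⟨w₁, hw₁, hc₁⟩ := h₁.exists_untwisting hA hφ₁
  obtain ⟨w₂, hw₂, hc₂⟩ := h₂.exists_untwisting hA hφ₂
  have hone : w₁ 1 = w₂ 1 := by rw [untwisting_one h₁ hc₁, untwisting_one h₂ hc₂]; rfl
  -- The middle factor makes `w` restrict to `w₁` and `w₂`, thanks to `w₁ 1 = w₂ 1`; off the two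
  -- subgroups any measurable choice would do.
  let w : G₁ × G₂ → unitary 𝓜(ℂ, A) := fun p => w₁ p.1 * (w₁ 1)⁻¹ * w₂ p.2
  have hw : StrictlyMeasurable w :=
    ((hw₁.comp measurable_fst).mul (.const _)).mul (hw₂.comp measurable_snd)
  have e₁ : ∀ x, w (x, 1) = w₁ x := fun x => by
    change w₁ x * (w₁ 1)⁻¹ * w₂ 1 = w₁ x
    rw [hone, inv_mul_cancel_right]
  have e₂ : ∀ X, w (1, X) = w₂ X := fun X => by
    change w₁ 1 * (w₁ 1)⁻¹ * w₂ X = w₂ X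
    rw [mul_inv_cancel, one_mul]
  refine ⟨fun ξ => ad (w ξ) * β ξ,
    fun ξ η => w ξ * onUnitary (β ξ) (w η) * v ξ η * (w (ξ * η))⁻¹,
    h.exterior hw (c := fun _ _ => 1) (by fun_prop) (fun _ => rfl)
      (fun _ _ => by rw [map_one, one_mul]) (fun _ _ _ => by simp [coboundary]),
    ⟨w, hw, fun _ => rfl, fun _ _ => rfl⟩, fun x y => ?_, fun X Y => ?_⟩
  · beta_reduce
    rw [Prod.mk_mul_mk, mul_one, e₁, e₁, e₁, hc₁]
    exact mul_inv_cancel _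
  · beta_reduce
    rw [Prod.mk_mul_mk, mul_one, e₂, e₂, e₂, hc₂]
    exact mul_inv_cancel _

theorem measurable_hatCochain (hφ : IsAntisymmTricharacter φ) :
    Measurable fun p : (G₁ × G₂) × (G₁ × G₂) => (hatCochain φ p.1 p.2 : ℂ) := by
  simp only [hatCochain, Circle.coe_div]
  refine .div (hφ.measurable.comp (f := fun p : (G₁ × G₂) × (G₁ × G₂) =>
      (((p.1.1, 1) : G₁ × G₂), ((p.2.1, 1) : G₁ × G₂), ((1, p.1.2 * p.2.2) : G₁ × G₂)))
      (by fun_prop))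
    (hφ.measurable.comp (f := fun p : (G₁ × G₂) × (G₁ × G₂) =>
      (((p.1.1, 1) : G₁ × G₂), ((1, p.1.2) : G₁ × G₂), p.2)) (by fun_prop))

end Product

end TwistedAction

end

/-! ### The theorem -/

theorem mainTheorem4
    {G₁ G₂ A : Type*}
    [CommGroup G₁] [TopologicalSpace G₁] [IsTopologicalGroup G₁] [T2Space G₁]
    [LocallyCompactSpace G₁] [SecondCountableTopology G₁] [MeasurableSpace G₁] [BorelSpace G₁]
    [CommGroup G₂] [TopologicalSpace G₂] [IsTopologicalGroup G₂] [T2Space G₂]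
    [LocallyCompactSpace G₂] [SecondCountableTopology G₂] [MeasurableSpace G₂] [BorelSpace G₂]
    [NonUnitalCStarAlgebra A] (hA : IsStable A)
    (hG₁ : MooreH3Trivial G₁) (hG₂ : MooreH3Trivial G₂)
    (φ : G₁ × G₂ → G₁ × G₂ → G₁ × G₂ → Circle) (hφ : IsAntisymmTricharacter φ)
    (hφ₁ : ∀ x y z : G₁, φ (x, 1) (y, 1) (z, 1) = 1)
    (hφ₂ : ∀ (X Y : G₂) (ζ : G₁ × G₂),
      φ (1, X) (1, Y) ζ = 1 ∧ φ (1, X) ζ (1, Y) = 1 ∧ φ ζ (1, X) (1, Y) = 1)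
    (β : G₁ × G₂ → (A ≃⋆ₐ[ℂ] A)) (v : G₁ × G₂ → G₁ × G₂ → unitary 𝓜(ℂ, A))
    (hβ : IsTwistedAction β v φ) :
    -- `v` may be taken to be trivial on the subgroups
    (∃ (β' : G₁ × G₂ → (A ≃⋆ₐ[ℂ] A)) (v' : G₁ × G₂ → G₁ × G₂ → unitary 𝓜(ℂ, A)),
      IsTwistedAction β' v' φ ∧ ExteriorEquivalent β v β' v' ∧ TrivialOnFactors v') ∧
    -- and, however this is done, the remaining assertions hold
    (∀ (β' : G₁ × G₂ → (A ≃⋆ₐ[ℂ] A)) (v' : G₁ × G₂ → G₁ × G₂ → unitary 𝓜(ℂ, A)),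
      IsTwistedAction β' v' φ → ExteriorEquivalent β v β' v' → TrivialOnFactors v' →
        IsTwistedAction (hatAction β') (hatTwist β' v') (hatCocycle φ) ∧
        ExteriorEquivalentUpToScalars β' v' φ
          (hatAction β') (hatTwist β' v') (hatCocycle φ) ∧
        ExteriorEquivalentUpToScalars β v φ
          (hatAction β') (hatTwist β' v') (hatCocycle φ) ∧
        (∀ (X Y : G₂) (z : G₁), tildeTwist v' (X * Y) z =
          onUnitary (β' (1, X)) (tildeTwist v' Y z) * tildeTwist v' X z) ∧
        (∀ (X : G₂) (y z : G₁), (tildeTwist v' X (y * z) : 𝓜(ℂ, A)) =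
          (((φ (1, X) (y, 1) (z, 1))⁻¹ ^ 3 : Circle) : ℂ) •
            ((tildeTwist v' X y * onUnitary (β' (y, 1)) (tildeTwist v' X z) :
              unitary 𝓜(ℂ, A)) : 𝓜(ℂ, A)))) ∧
    -- the three-cocycle of `v̂` has antisymmetrisation `φ`
    (∀ ξ η ζ : G₁ × G₂,
      φ ξ η ζ ^ 3 = hatCocycle φ ξ η ζ * hatCocycle φ η ζ ξ * hatCocycle φ ζ ξ η ∧
      φ ξ η ζ = φ (1, ξ.2) (η.1, 1) (ζ.1, 1) * φ (1, η.2) (ζ.1, 1) (ξ.1, 1) *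
        φ (1, ζ.2) (ξ.1, 1) (η.1, 1)) := by
  refine ⟨exists_trivialOnFactors hA hβ hφ₁ fun X Y Z => (hφ₂ X Y _).1,
    fun β' v' hβ' hext htriv => ?_, fun ξ η ζ => ?_⟩
  · have hw : StrictlyMeasurable fun ξ : G₁ × G₂ => v' (ξ.1, 1) (1, ξ.2) :=
      hβ'.measurable_twist.comp (g := fun ξ : G₁ × G₂ => ((ξ.1, 1), (1, ξ.2))) (by fun_prop)
    have hc := measurable_hatCochain hφ
    have hcob := hatCocycle_eq_mul_coboundary hφ hφ₁ hφ₂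
    have hhat : IsTwistedAction (hatAction β') (hatTwist β' v') (hatCocycle φ) :=
      hβ'.exterior hw hc (hatAction_eq hβ') (hatTwist_eq hβ' htriv hφ₂) hcob
    have hequiv : ExteriorEquivalentUpToScalars β' v' φ
        (hatAction β') (hatTwist β' v') (hatCocycle φ) :=
      ⟨_, _, hw, hc, hatAction_eq hβ',
        fun ξ η => eq_scalar_mul_iff.2 (hatTwist_eq hβ' htriv hφ₂ ξ η), hcob⟩
    have hone : β' (1, 1) = 1 := by
      have := hβ'.action_one
      rwa [Prod.one_eq_mk, htriv.1, ad_one] at this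
    have ht₁ : ∀ X, tildeTwist v' X 1 = 1 := fun X => by
      rw [tildeTwist, htriv.2, htriv.2, inv_one, one_mul]
    have ht₂ : ∀ z, tildeTwist v' 1 z = 1 := fun z => by
      rw [tildeTwist, htriv.1, htriv.1, inv_one, one_mul]
    have hφ_one : ∀ ξ η, φ ξ (1, 1) η = 1 := fun ξ η => by
      have := hφ.map_mul₂ ξ (1, 1) (1, 1) η
      rwa [Prod.mk_mul_mk, mul_one, mul_one, left_eq_mul] at this
    refine ⟨hhat, hequiv, hext.trans_upToScalars hequiv, fun X Y z => ?_, fun X y z => ?_⟩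
    -- At `(X, Y, z)` the term `v̂(X,Y) = ṽ(X,1)` is 1 and `v̂(X, Yz) = ṽ(X,z)`, since `v̂` ignores
    -- the `G₂`-part of its second argument.
    · have := hhat.cocycle_eq (1, X) (1, Y) (z, 1)
      simp only [hatTwist, hatAction, hatCocycle, Prod.mk_mul_mk, one_mul, mul_one, hone, ht₁,
        onUnitary_one_aut, hφ_one, one_pow, map_one] at this
      exact this
    -- At `(X, y, z)` the term `v̂(y,z) = β'_y[ṽ(1,z)]` is 1, and `v̂(yX, z)` supplies the factor
    -- `β'_y[ṽ(X,z)]`.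
    · have := hhat.cocycle_eq (1, X) (y, 1) (z, 1)
      simp only [hatTwist, hatAction, hatCocycle, Prod.mk_mul_mk, one_mul, mul_one, hone, ht₂,
        onUnitary_one_aut, map_one] at this
      rw [eq_scalar_mul_iff, this, ← mul_assoc, ← map_mul, inv_pow, inv_mul_cancel, map_one,
        one_mul]
  · have h := hφ.eq_cyclic hφ₁ hφ₂ ξ η ζ
    refine ⟨?_, h⟩
    rw [h, mul_pow, mul_pow]
    rfl
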